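/- Let $n\ge 2$. A bounded domain (non-empty, open, connected, bounded set) $D\subset\mathbb R^n$ with a function $s:D\to[1,\infty)$ is called an $s(\cdot)$-John domain with John constants $0<\alpha\le\beta<\infty$ and John center $x_0\in D$ if every $x\in D$ can be joined to $x_0$ by a rectifiable curve $\gamma_x:[0,\ell(\gamma_x)]\to D$, parametrized by arc length, with $\gamma_x(0)=x$, $\gamma_x(\ell(\gamma_x))=x_0$, $\ell(\gamma_x)\le\beta$ and \[ t^{s(x)}\le\frac{\beta}{\alpha}\,\operatorname{dist}(\gamma_x(t),\partial D)\qquad\text{for all } t\in[0,\ell(\gamma_x)]. \] Write $s^-$ and $s^+$ for the essential infimum and supremum of $s$ over $D$. For a measurable exponent $q:D\to[1,\infty)$ let \[ \|f\|_{L^{q(\cdot)}(D)}=\inf\Big\{\lambda>0:\int_D\Big|\frac{f(x)}{\lambda}\Big|^{q(x)}dx\le 1\Big\} \] be the Luxemburg norm, and let $L^1_1(D)$ be the set of all $u\in W^{1,1}_{\mathrm{loc}}(D)$ whose distributional gradient satisfies $|\nabla u|\in L^1(D)$. Theorem (Sobolev–Poincaré inequality, $p=1$). Let $D\subset\mathbb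 R^n$, $n\ge2$, be an $s(\cdot)$-John domain with John constants $\alpha,\beta$ and John center $x_0$. Assume that $s$ is log-Hölder continuous on $D$, that is, for some constant $L>0$, \[ |s(x)-s(y)|\le\frac{L}{\log(e+1/|x-y|)}\qquad\text{for all }x,y\in D,\ x\ne y, \] and that $1\le s^-\le s^+<\frac{n}{n-1}$. Put $B=B(x_0,\operatorname{dist}(x_0,\partial D))$ and $q(x)=\frac{n}{s(x)(n-1)}$. Then there is a constant $c$, depending only on $n$, $\alpha$, $\beta$, $s^+$, $\operatorname{dist}(x_0,\partial D)$ and $L$, such that every $u\in L^1_1(D)$ is integrable over $B$ and, with $u_B=\frac1{|B|}\int_B u\,dx$, \[ \|u-u_B\|_{L^{q(\cdot)}(D)}\le c\,\|\nabla u\|_{L^1(D)}. \] -/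

import Mathlib

open MeasureTheory Set
open scoped ENNReal NNReal ContDiff

noncomputable section

/-- `D` is a bounded `s(·)`-John domain with John constants `α ≤ β` and John center `x₀`: `D` is a
bounded domain, `s ≥ 1` on `D`, and every `x ∈ D` is joined to `x₀` inside `D` by a rectifiable
curve `γ : [0, ℓ] → D`, parametrized by arc length, of length `ℓ ≤ β`, such that
`t ^ s(x) ≤ (β / α) dist (γ t, ∂D)` for all `t ∈ [0, ℓ]`. Only the values of `s` on `D` matter. -/
structure IsJohnDomain {n : ℕ} (D : Set (EuclideanSpace ℝ (Fin n)))
    (s : EuclideanSpace ℝ (Fin n) → ℝ) (α β : ℝ) (x₀ : EuclideanSpace ℝ (Fin n)) : Prop where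
  isOpen : IsOpen D
  isConnected : IsConnected D
  isBounded : Bornology.IsBounded D
  one_le : ∀ x ∈ D, 1 ≤ s x
  alpha_pos : 0 < α
  alpha_le_beta : α ≤ β
  center_mem : x₀ ∈ D
  exists_curve : ∀ x ∈ D, ∃ (ℓ : ℝ) (γ : ℝ → EuclideanSpace ℝ (Fin n)),
    0 ≤ ℓ ∧ ℓ ≤ β ∧ HasUnitSpeedOn γ (Icc 0 ℓ) ∧ MapsTo γ (Icc 0 ℓ) D ∧
    γ 0 = x ∧ γ ℓ = x₀ ∧
    ∀ t ∈ Icc (0 : ℝ) ℓ, t ^ s x ≤ β / α * Metric.infDist (γ t) (frontier D)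

/-- The essential supremum `g⁺` of `g` over `U`, as an extended real number. -/
def essSupOn {n : ℕ} (g : EuclideanSpace ℝ (Fin n) → ℝ)
    (U : Set (EuclideanSpace ℝ (Fin n))) : EReal :=
  essSup (fun x => (g x : EReal)) (volume.restrict U)

/-- The essential infimum `g⁻` of `g` over `U`, as an extended real number. -/
def essInfOn {n : ℕ} (g : EuclideanSpace ℝ (Fin n) → ℝ)
    (U : Set (EuclideanSpace ℝ (Fin n))) : EReal :=
  essInf (fun x => (g x : EReal)) (volume.restrict U)

/-- `g` is log-Hölder continuous on `U` with constant `L > 0`. -/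
def LogHolderOnWith {n : ℕ} (L : ℝ) (g : EuclideanSpace ℝ (Fin n) → ℝ)
    (U : Set (EuclideanSpace ℝ (Fin n))) : Prop :=
  0 < L ∧ ∀ x ∈ U, ∀ y ∈ U, x ≠ y →
    |g x - g y| ≤ L / Real.log (Real.exp 1 + 1 / dist x y)

/-- The class of variable exponents on `U`: measurable, `[1, ∞)`-valued, with
`1 ≤ p⁻ ≤ p⁺ < ∞`. -/
structure IsVariableExponent {n : ℕ} (p : EuclideanSpace ℝ (Fin n) → ℝ)
    (U : Set (EuclideanSpace ℝ (Fin n))) : Prop where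
  aemeasurable : AEMeasurable p (volume.restrict U)
  one_le : ∀ x ∈ U, 1 ≤ p x
  essSup_lt_top : essSupOn p U < ⊤

/-- The modular `∫_U |f(x)|^{p(x)} dx` of the variable exponent Lebesgue space. -/
def modular {n : ℕ} (p f : EuclideanSpace ℝ (Fin n) → ℝ)
    (U : Set (EuclideanSpace ℝ (Fin n))) : ℝ≥0∞ :=
  ∫⁻ x in U, ENNReal.ofReal (|f x| ^ p x)

/-- The Luxemburg–Nakano norm `inf {t > 0 : modular (f / t) ≤ 1}` of `L^{p(·)}(U)`; it is `∞` if
there is no such `t`. -/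
def luxemburgNorm {n : ℕ} (p f : EuclideanSpace ℝ (Fin n) → ℝ)
    (U : Set (EuclideanSpace ℝ (Fin n))) : ℝ≥0∞ :=
  ⨅ t ∈ {t : ℝ | 0 < t ∧ modular p (fun x => f x / t) U ≤ 1}, ENNReal.ofReal t

/-- `u ∈ W^{1,1}_loc(U)` with distributional gradient `G`. -/
structure HasWeakGradientOn {n : ℕ} (u : EuclideanSpace ℝ (Fin n) → ℝ)
    (G : EuclideanSpace ℝ (Fin n) → EuclideanSpace ℝ (Fin n))
    (U : Set (EuclideanSpace ℝ (Fin n))) : Prop where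
  locallyIntegrableOn : LocallyIntegrableOn u U
  locallyIntegrableOn_gradient : LocallyIntegrableOn G U
  integral_eq : ∀ φ : EuclideanSpace ℝ (Fin n) → ℝ,
    ContDiff ℝ ∞ φ → HasCompactSupport φ → tsupport φ ⊆ U →
    ∀ v : EuclideanSpace ℝ (Fin n),
      ∫ x in U, u x * fderiv ℝ φ x v = -∫ x in U, inner ℝ (G x) v * φ x

/-- `u ∈ L^1_1(U)` with distributional gradient `G`: `u ∈ W^{1,1}_loc(U)` and
`|∇u| ∈ L^1(U)`. -/
def MemL11With {n : ℕ} (u : EuclideanSpace ℝ (Fin n) → ℝ)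
    (G : EuclideanSpace ℝ (Fin n) → EuclideanSpace ℝ (Fin n))
    (U : Set (EuclideanSpace ℝ (Fin n))) : Prop :=
  HasWeakGradientOn u G U ∧ IntegrableOn G U

end

/-!
Mollification reduces the Poincaré inequality on balls compactly contained in `D` to smooth
functions, and a chain of such balls along the John curve of `x` telescopes it to the pointwise
bound of `|v x - v_B|` by `∫ |∇v y| |x - y| ^ (-s(x) (n - 1)) dy`, a Riesz potential whose order
varies with `x`. Log-Hölder continuity allows the exponent to be frozen up to a constant factor,
which makes the potential of weak type `(1, n / (s(·) (n - 1)))`. Since the gradient of a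
truncation of `v` at the levels `l` and `2 l` lives where `l < |v| < 2 l`, applying the weak type
bound to these truncations and summing over dyadic `l` upgrades it to the strong bound (Maz'ya's
truncation method).
-/

/-! ### The Poincaré inequality on balls for smooth functions -/

section SmoothPoincare

theorem lintegral_lintegral_lintegral_rotate {X Y T : Type*} [MeasurableSpace X]
    [MeasurableSpace Y] [MeasurableSpace T] {μ : Measure X} {ν : Measure Y} {τ : Measure T}
    [SFinite μ] [SFinite ν] [SFinite τ] {f : (X × Y) × T → ℝ≥0∞} (hf : Measurable f) :
    ∫⁻ x, ∫⁻ y, ∫⁻ t, f ((x, y), t) ∂τ ∂ν ∂μ = ∫⁻ t, ∫⁻ x, ∫⁻ y, f ((x, y), t) ∂ν ∂μ ∂τ := by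
  calc ∫⁻ x, ∫⁻ y, ∫⁻ t, f ((x, y), t) ∂τ ∂ν ∂μ
      = ∫⁻ x, ∫⁻ t, ∫⁻ y, f ((x, y), t) ∂ν ∂τ ∂μ := by
        refine lintegral_congr fun x => lintegral_lintegral_swap ?_
        exact (hf.comp (by fun_prop : Measurable fun p : Y × T => ((x, p.1), p.2))).aemeasurable
    _ = ∫⁻ t, ∫⁻ x, ∫⁻ y, f ((x, y), t) ∂ν ∂μ ∂τ := by
        refine lintegral_lintegral_swap (Measurable.aemeasurable ?_)
        exact Measurable.lintegral_prod_right' (f := fun p : (X × T) × Y => f ((p.1.1, p.2), p.1.2))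
          (hf.comp (by fun_prop))

variable {V : Type*} [NormedAddCommGroup V] [NormedSpace ℝ V]

theorem enorm_sub_le_lintegral_enorm_fderiv {f : V → ℝ} (hf : ContDiff ℝ 1 f) (x y : V) :
    ‖f x - f y‖ₑ ≤ ‖y - x‖ₑ *
      ∫⁻ t in Ioc (0 : ℝ) 1, ‖fderiv ℝ f ((1 - t) • x + t • y)‖ₑ := by
  have hasDerivAt_segment (t : ℝ) : HasDerivAt (fun t : ℝ => f ((1 - t) • x + t • y))
      (fderiv ℝ f ((1 - t) • x + t • y) (y - x)) t := by
    have hline : HasDerivAt (fun t : ℝ => (1 - t) • x + t • y) (y - x) t := by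
      refine ((((hasDerivAt_id t).const_sub 1).smul_const x).add
        ((hasDerivAt_id t).smul_const y)).congr_deriv ?_
      rw [neg_one_smul, one_smul, neg_add_eq_sub]
    exact (hf.differentiable one_ne_zero _).hasFDerivAt.comp_hasDerivAt t hline
  have hcont : Continuous fun t : ℝ => fderiv ℝ f ((1 - t) • x + t • y) :=
    (hf.continuous_fderiv one_ne_zero).comp (by fun_prop)
  have hftc : ∫ t in Ioc (0 : ℝ) 1, fderiv ℝ f ((1 - t) • x + t • y) (y - x) = f y - f x := by
    rw [← intervalIntegral.integral_of_le zero_le_one,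
      intervalIntegral.integral_eq_sub_of_hasDerivAt (fun t _ => hasDerivAt_segment t)
        ((hcont.clm_apply continuous_const).intervalIntegrable 0 1)]
    simp
  rw [enorm_sub_rev, ← hftc, ← lintegral_const_mul _ hcont.enorm.measurable]
  refine (enorm_integral_le_lintegral_enorm _).trans (lintegral_mono fun t => ?_)
  exact (ContinuousLinearMap.le_opENorm _ _).trans_eq (mul_comm _ _)

variable [FiniteDimensional ℝ V] [MeasurableSpace V] [BorelSpace V] {μ : Measure V}
  [μ.IsAddHaarMeasure]

theorem lintegral_comp_add_smul {h : V → ℝ≥0∞} (hh : Measurable h) (a : V) {t : ℝ} (ht : t ≠ 0) :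
    ∫⁻ y, h (a + t • y) ∂μ
      = ENNReal.ofReal |(t ^ Module.finrank ℝ V)⁻¹| * ∫⁻ y, h y ∂μ := by
  calc ∫⁻ y, h (a + t • y) ∂μ = ∫⁻ y, h (a + y) ∂(Measure.map (t • ·) μ) := by
        rw [lintegral_map (by fun_prop) (by fun_prop)]
    _ = _ := by
        rw [Measure.map_addHaar_smul μ ht, lintegral_smul_measure,
          lintegral_add_left_eq_self, smul_eq_mul]

theorem setLIntegral_comp_convexCombination_le {h : V → ℝ≥0∞} (hh : Measurable h) {z : V} {r : ℝ}
    {t : ℝ} (ht : 1 / 2 ≤ t) (ht1 : t ≤ 1) {x : V} (hx : x ∈ Metric.ball z r) :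
    ∫⁻ y in Metric.ball z r, h ((1 - t) • x + t • y) ∂μ
      ≤ 2 ^ Module.finrank ℝ V * ∫⁻ y in Metric.ball z r, h y ∂μ := by
  have ht0 : 0 < t := by linarith
  have hm : MeasurableSet (Metric.ball z r) := measurableSet_ball
  calc ∫⁻ y in Metric.ball z r, h ((1 - t) • x + t • y) ∂μ
      ≤ ∫⁻ y, (Metric.ball z r).indicator h ((1 - t) • x + t • y) ∂μ := by
        rw [← lintegral_indicator hm]
        refine lintegral_mono fun y => indicator_apply_le' (fun hy => ?_) fun _ => zero_le
        rw [indicator_of_mem (convex_ball z r hx hy (by linarith) ht0.le (by ring))]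
    _ = ENNReal.ofReal |(t ^ Module.finrank ℝ V)⁻¹| * ∫⁻ y in Metric.ball z r, h y ∂μ := by
        rw [lintegral_comp_add_smul (hh.indicator hm) _ ht0.ne', lintegral_indicator hm]
    _ ≤ 2 ^ Module.finrank ℝ V * ∫⁻ y in Metric.ball z r, h y ∂μ := by
        gcongr
        have hinv : t⁻¹ ≤ 2 := by rw [inv_le_comm₀ ht0 two_pos]; linarith
        rw [abs_of_pos (by positivity), ← inv_pow, ENNReal.ofReal_pow (by positivity)]
        gcongr
        exact (ENNReal.ofReal_le_ofReal hinv).trans_eq (ENNReal.ofReal_ofNat 2)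

theorem lintegral_lintegral_comp_convexCombination_le {h : V → ℝ≥0∞} (hh : Measurable h) {z : V}
    {r : ℝ} {t : ℝ} (ht : 0 ≤ t) (ht1 : t ≤ 1) :
    ∫⁻ x in Metric.ball z r, ∫⁻ y in Metric.ball z r, h ((1 - t) • x + t • y) ∂μ ∂μ
      ≤ 2 ^ Module.finrank ℝ V * μ (Metric.ball z r) * ∫⁻ y in Metric.ball z r, h y ∂μ := by
  have of_half_le (t : ℝ) (ht : 1 / 2 ≤ t) (ht1 : t ≤ 1) :
      ∫⁻ x in Metric.ball z r, ∫⁻ y in Metric.ball z r, h ((1 - t) • x + t • y) ∂μ ∂μ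
      ≤ 2 ^ Module.finrank ℝ V * μ (Metric.ball z r) * ∫⁻ y in Metric.ball z r, h y ∂μ := by
    refine (setLIntegral_mono' measurableSet_ball fun x hx =>
      setLIntegral_comp_convexCombination_le hh ht ht1 hx).trans_eq ?_
    rw [setLIntegral_const]
    ring
  rcases le_total (1 / 2) t with h2 | h2
  · exact of_half_le t h2 ht1
  · rw [lintegral_lintegral_swap (by fun_prop)]
    simpa only [sub_sub_cancel, add_comm] using of_half_le (1 - t) (by linarith) (by linarith)

theorem lintegral_lintegral_enorm_sub_le_of_contDiff {f : V → ℝ} (hf : ContDiff ℝ 1 f) (z : V)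
    (r : ℝ) :
    ∫⁻ x in Metric.ball z r, ∫⁻ y in Metric.ball z r, ‖f x - f y‖ₑ ∂μ ∂μ
      ≤ 2 ^ (Module.finrank ℝ V + 1) * ENNReal.ofReal r * μ (Metric.ball z r)
        * ∫⁻ y in Metric.ball z r, ‖fderiv ℝ f y‖ₑ ∂μ := by
  set h : V → ℝ≥0∞ := fun y => ‖fderiv ℝ f y‖ₑ
  have hh : Continuous h := (hf.continuous_fderiv one_ne_zero).enorm
  calc ∫⁻ x in Metric.ball z r, ∫⁻ y in Metric.ball z r, ‖f x - f y‖ₑ ∂μ ∂μ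
      ≤ ∫⁻ x in Metric.ball z r, ∫⁻ y in Metric.ball z r, ∫⁻ t in Ioc (0 : ℝ) 1,
          ENNReal.ofReal (2 * r) * h ((1 - t) • x + t • y) ∂volume ∂μ ∂μ := by
        refine setLIntegral_mono' measurableSet_ball fun x hx =>
          setLIntegral_mono' measurableSet_ball fun y hy => ?_
        refine (enorm_sub_le_lintegral_enorm_fderiv hf x y).trans ?_
        rw [lintegral_const_mul' _ _ ENNReal.ofReal_ne_top, ← ofReal_norm, ← dist_eq_norm]
        gcongr
        have := dist_triangle_right y x z
        rw [Metric.mem_ball] at hx hy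
        linarith
    _ = ∫⁻ t in Ioc (0 : ℝ) 1, ∫⁻ x in Metric.ball z r, ∫⁻ y in Metric.ball z r,
          ENNReal.ofReal (2 * r) * h ((1 - t) • x + t • y) ∂μ ∂μ :=
        lintegral_lintegral_lintegral_rotate (f := fun p : (V × V) × ℝ =>
          ENNReal.ofReal (2 * r) * h ((1 - p.2) • p.1.1 + p.2 • p.1.2)) (by fun_prop)
    _ ≤ ∫⁻ _ in Ioc (0 : ℝ) 1, ENNReal.ofReal (2 * r) *
          (2 ^ Module.finrank ℝ V * μ (Metric.ball z r) * ∫⁻ y in Metric.ball z r, h y ∂μ) := by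
        refine setLIntegral_mono' measurableSet_Ioc fun t ht => ?_
        simp_rw [lintegral_const_mul' _ _ ENNReal.ofReal_ne_top]
        gcongr
        exact lintegral_lintegral_comp_convexCombination_le hh.measurable ht.1.le ht.2
    _ = _ := by
        rw [setLIntegral_const, Real.volume_Ioc, sub_zero, ENNReal.ofReal_one, mul_one,
          ENNReal.ofReal_mul two_pos.le, ENNReal.ofReal_ofNat, pow_succ]
        ring

end SmoothPoincare

/-! ### Mollification in `L¹` -/

section Mollification

open Filter Topology Convolution

theorem tendsto_lintegral_enorm_sub_of_lintegral_enorm_le {Ω F : Type*} [MeasurableSpace Ω]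
    [NormedAddCommGroup F] {μ : Measure Ω} {f : ℕ → Ω → F} {g : Ω → F}
    (hf : ∀ k, AEStronglyMeasurable (f k) μ) (hg : Integrable g μ)
    (hlim : ∀ᵐ x ∂μ, Tendsto (fun k => f k x) atTop (𝓝 (g x)))
    (hle : ∀ k, ∫⁻ x, ‖f k x‖ₑ ∂μ ≤ ∫⁻ x, ‖g x‖ₑ ∂μ) :
    Tendsto (fun k => ∫⁻ x, ‖f k x - g x‖ₑ ∂μ) atTop (𝓝 0) := by
  set A := ∫⁻ x, ‖g x‖ₑ ∂μ
  have hA : A + A ≠ ⊤ := ENNReal.add_ne_top.2 ⟨hg.2.ne, hg.2.ne⟩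
  have hgm := hg.1.enorm
  -- `‖f k‖ + ‖g‖ - ‖f k - g‖` is dominated by `2 ‖g‖`, whereas `‖f k - g‖` has no majorant.
  set defect : ℕ → Ω → ℝ≥0∞ := fun k x => ‖f k x‖ₑ + ‖g x‖ₑ - ‖f k x - g x‖ₑ
  have defect_add (k : ℕ) (x : Ω) : defect k x + ‖f k x - g x‖ₑ = ‖f k x‖ₑ + ‖g x‖ₑ :=
    tsub_add_cancel_of_le enorm_sub_le
  have defect_le (k : ℕ) (x : Ω) : defect k x ≤ ‖g x‖ₑ + ‖g x‖ₑ := by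
    rw [tsub_le_iff_left, ← add_assoc]
    gcongr
    simpa using enorm_add_le (a := f k x - g x) (b := g x)
  have lim_defect : Tendsto (fun k => ∫⁻ x, defect k x ∂μ) atTop (𝓝 (A + A)) := by
    rw [← lintegral_add_left' hgm]
    refine tendsto_lintegral_of_dominated_convergence' _
      (fun k => ((hf k).enorm.add hgm).sub ((hf k).sub hg.1).enorm)
      (fun k => ae_of_all _ (defect_le k)) (by rwa [lintegral_add_left' hgm]) ?_
    filter_upwards [hlim] with x hx
    simpa using ENNReal.Tendsto.sub (hx.enorm.add tendsto_const_nhds)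
      (hx.sub_const (g x)).enorm (Or.inl (by finiteness))
  have enorm_sub_le_sub_defect (k : ℕ) :
      ∫⁻ x, ‖f k x - g x‖ₑ ∂μ ≤ A + A - ∫⁻ x, defect k x ∂μ := by
    refine ENNReal.le_sub_of_add_le_left (ne_top_of_le_ne_top hA ?_) ?_
    · exact (lintegral_mono (defect_le k)).trans_eq (lintegral_add_left' hgm _)
    · calc ∫⁻ x, defect k x ∂μ + ∫⁻ x, ‖f k x - g x‖ₑ ∂μ = ∫⁻ x, ‖f k x‖ₑ + ‖g x‖ₑ ∂μ := by
            rw [← lintegral_add_right' (g := fun x => ‖f k x - g x‖ₑ) _ ((hf k).sub hg.1).enorm]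
            simp_rw [defect_add]
        _ = (∫⁻ x, ‖f k x‖ₑ ∂μ) + A := lintegral_add_left' (hf k).enorm _
        _ ≤ A + A := by gcongr; exact hle k
  refine tendsto_of_tendsto_of_tendsto_of_le_of_le tendsto_const_nhds ?_
    (fun k => zero_le) enorm_sub_le_sub_defect
  simpa using ENNReal.Tendsto.sub (tendsto_const_nhds (x := A + A)) lim_defect (Or.inl hA)

variable {V : Type*} [NormedAddCommGroup V] [NormedSpace ℝ V] [FiniteDimensional ℝ V]
  [MeasurableSpace V] [BorelSpace V] {μ : Measure V} [μ.IsAddHaarMeasure]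
  [HasContDiffBump V]
  {F : Type*} [NormedAddCommGroup F] [NormedSpace ℝ F]

theorem lintegral_enorm_normed_contDiffBump (φ : ContDiffBump (0 : V)) :
    ∫⁻ t, ‖φ.normed μ t‖ₑ ∂μ = 1 := by
  simp_rw [Real.enorm_of_nonneg (φ.nonneg_normed _)]
  rw [← ofReal_integral_eq_lintegral_ofReal φ.integrable_normed
    (ae_of_all _ φ.nonneg_normed), φ.integral_normed, ENNReal.ofReal_one]

theorem lintegral_enorm_convolution_contDiffBump_le (φ : ContDiffBump (0 : V)) {f : V → F}
    (hf : Integrable f μ) :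
    ∫⁻ x, ‖(φ.normed μ ⋆[ContinuousLinearMap.lsmul ℝ ℝ, μ] f) x‖ₑ ∂μ ≤ ∫⁻ x, ‖f x‖ₑ ∂μ := by
  calc ∫⁻ x, ‖(φ.normed μ ⋆[ContinuousLinearMap.lsmul ℝ ℝ, μ] f) x‖ₑ ∂μ
      ≤ ∫⁻ x, ∫⁻ t, ‖φ.normed μ t‖ₑ * ‖f (x - t)‖ₑ ∂μ ∂μ := by
        refine lintegral_mono fun x => ?_
        rw [convolution_def]
        refine (enorm_integral_le_lintegral_enorm _).trans (lintegral_mono fun t => ?_)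
        simp [enorm_smul]
    _ = ∫⁻ t, ∫⁻ x, ‖φ.normed μ t‖ₑ * ‖f (x - t)‖ₑ ∂μ ∂μ := by
        refine lintegral_lintegral_swap ?_
        have := (φ.integrable_normed (μ := μ)).aestronglyMeasurable.convolution_integrand
          (ContinuousLinearMap.lsmul ℝ ℝ) hf.aestronglyMeasurable (μ := μ)
        refine this.enorm.congr (ae_of_all _ fun p => ?_)
        simp [enorm_smul, Function.uncurry]
    _ = ∫⁻ t, ‖φ.normed μ t‖ₑ * ∫⁻ x, ‖f x‖ₑ ∂μ ∂μ := by
        refine lintegral_congr fun t => ?_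
        rw [lintegral_const_mul' _ _ enorm_ne_top,
          lintegral_sub_right_eq_self (fun x => ‖f x‖ₑ)]
    _ = ∫⁻ x, ‖f x‖ₑ ∂μ := by
        rw [lintegral_mul_const _ φ.continuous_normed.enorm.measurable,
          lintegral_enorm_normed_contDiffBump, one_mul]

theorem tendsto_lintegral_enorm_convolution_sub [CompleteSpace F]
    {φ : ℕ → ContDiffBump (0 : V)} {K : ℝ}
    (hφ : Tendsto (fun i => (φ i).rOut) atTop (𝓝 0))
    (h'φ : ∀ᶠ i in atTop, (φ i).rOut ≤ K * (φ i).rIn) {f : V → F} (hf : Integrable f μ) :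
    Tendsto (fun k => ∫⁻ x,
      ‖((φ k).normed μ ⋆[ContinuousLinearMap.lsmul ℝ ℝ, μ] f) x - f x‖ₑ ∂μ) atTop (𝓝 0) :=
  tendsto_lintegral_enorm_sub_of_lintegral_enorm_le
    (fun k => ((φ k).hasCompactSupport_normed.continuous_convolution_left _
      (φ k).continuous_normed hf.locallyIntegrable).aestronglyMeasurable) hf
    (ContDiffBump.ae_convolution_tendsto_right_of_locallyIntegrable hφ h'φ hf.locallyIntegrable)
    fun k => lintegral_enorm_convolution_contDiffBump_le (φ k) hf

end Mollification

/-! ### Approximation of weakly differentiable functions -/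

section WeakPoincare

open Filter Topology Convolution

theorem lintegral_lintegral_enorm_sub_le_liminf {Ω : Type*} [MeasurableSpace Ω] {μ : Measure Ω}
    [SFinite μ] {f : ℕ → Ω → ℝ} {g : Ω → ℝ} (hf : ∀ k, Measurable (f k))
    (hlim : ∀ᵐ x ∂μ, Tendsto (fun k => f k x) atTop (𝓝 (g x))) :
    ∫⁻ x, ∫⁻ y, ‖g x - g y‖ₑ ∂μ ∂μ
      ≤ liminf (fun k => ∫⁻ x, ∫⁻ y, ‖f k x - f k y‖ₑ ∂μ ∂μ) atTop := by
  calc ∫⁻ x, ∫⁻ y, ‖g x - g y‖ₑ ∂μ ∂μ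
      ≤ ∫⁻ x, liminf (fun k => ∫⁻ y, ‖f k x - f k y‖ₑ ∂μ) atTop ∂μ := by
        refine lintegral_mono_ae ?_
        filter_upwards [hlim] with x hx
        calc ∫⁻ y, ‖g x - g y‖ₑ ∂μ = ∫⁻ y, liminf (fun k => ‖f k x - f k y‖ₑ) atTop ∂μ := by
              refine lintegral_congr_ae ?_
              filter_upwards [hlim] with y hy
              exact (hx.sub hy).enorm.liminf_eq.symm
          _ ≤ _ := lintegral_liminf_le fun k => by fun_prop
    _ ≤ liminf (fun k => ∫⁻ x, ∫⁻ y, ‖f k x - f k y‖ₑ ∂μ ∂μ) atTop :=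
        lintegral_liminf_le fun k => Measurable.lintegral_prod_right'
          (f := fun p : Ω × Ω => ‖f k p.1 - f k p.2‖ₑ) (by fun_prop)

theorem liminf_lintegral_enorm_fderiv_comp_le {V : Type*} [NormedAddCommGroup V]
    [NormedSpace ℝ V] [MeasurableSpace V] [BorelSpace V] {ν : Measure V} {f : ℕ → V → ℝ}
    {u : V → ℝ} {F : V → V →L[ℝ] ℝ} (hf : ∀ k, ContDiff ℝ 1 (f k)) (hF : Integrable F ν)
    (hlim : ∀ᵐ x ∂ν, Tendsto (fun k => f k x) atTop (𝓝 (u x)))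
    (hlim' : Tendsto (fun k => ∫⁻ x, ‖fderiv ℝ (f k) x - F x‖ₑ ∂ν) atTop (𝓝 0))
    {Φ : ℝ → ℝ} (hΦ : ContDiff ℝ 1 Φ) {M : ℝ≥0} (hM : ∀ t, ‖deriv Φ t‖ₑ ≤ M) :
    liminf (fun k => ∫⁻ x, ‖fderiv ℝ (Φ ∘ f k) x‖ₑ ∂ν) atTop
      ≤ ∫⁻ x, ‖deriv Φ (u x)‖ₑ * ‖F x‖ₑ ∂ν := by
  have hΦ' : Continuous (deriv Φ) := hΦ.continuous_deriv le_rfl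
  have hmeas (k : ℕ) : AEMeasurable (fun x => ‖deriv Φ (f k x)‖ₑ * ‖F x‖ₑ) ν :=
    (hΦ'.comp (hf k).continuous).enorm.aemeasurable.mul hF.aestronglyMeasurable.enorm
  have lintegral_fderiv_comp_le (k : ℕ) : ∫⁻ x, ‖fderiv ℝ (Φ ∘ f k) x‖ₑ ∂ν
      ≤ (∫⁻ x, ‖deriv Φ (f k x)‖ₑ * ‖F x‖ₑ ∂ν) + M * ∫⁻ x, ‖fderiv ℝ (f k) x - F x‖ₑ ∂ν := by
    rw [← lintegral_const_mul' _ _ ENNReal.coe_ne_top, ← lintegral_add_left' (hmeas k)]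
    refine lintegral_mono fun x => ?_
    have hchain : fderiv ℝ (Φ ∘ f k) x = deriv Φ (f k x) • fderiv ℝ (f k) x :=
      ((hΦ.differentiable one_ne_zero _).hasDerivAt.comp_hasFDerivAt x
        ((hf k).differentiable one_ne_zero x).hasFDerivAt).fderiv
    calc ‖fderiv ℝ (Φ ∘ f k) x‖ₑ
        ≤ ‖deriv Φ (f k x)‖ₑ * (‖F x‖ₑ + ‖fderiv ℝ (f k) x - F x‖ₑ) := by
          rw [hchain, enorm_smul]
          gcongr
          simpa using enorm_add_le (F x) (fderiv ℝ (f k) x - F x)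
      _ ≤ _ := by rw [mul_add]; gcongr; exact hM _
  have hdom : Tendsto (fun k => ∫⁻ x, ‖deriv Φ (f k x)‖ₑ * ‖F x‖ₑ ∂ν) atTop
      (𝓝 (∫⁻ x, ‖deriv Φ (u x)‖ₑ * ‖F x‖ₑ ∂ν)) := by
    refine tendsto_lintegral_of_dominated_convergence' (fun x => M * ‖F x‖ₑ) hmeas
      (fun k => ae_of_all _ fun x => mul_le_mul_left (hM _) _) ?_ ?_
    · rw [lintegral_const_mul' _ _ ENNReal.coe_ne_top]
      exact ENNReal.mul_ne_top ENNReal.coe_ne_top hF.2.ne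
    · filter_upwards [hlim] with x hx
      exact ENNReal.Tendsto.mul_const ((hΦ'.tendsto _).comp hx).enorm (Or.inr enorm_ne_top)
  have hbound := hdom.add (ENNReal.Tendsto.const_mul hlim' (Or.inr (ENNReal.coe_ne_top (r := M))))
  rw [mul_zero, add_zero] at hbound
  exact (liminf_le_liminf (Eventually.of_forall lintegral_fderiv_comp_le)).trans_eq
    hbound.liminf_eq

theorem tsupport_comp_const_sub_subset {V : Type*} [NormedAddCommGroup V] {φ : V → ℝ} {ρ : ℝ}
    (hφ : tsupport φ ⊆ Metric.closedBall 0 ρ) (x : V) :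
    tsupport (fun y => φ (x - y)) ⊆ Metric.closedBall x ρ := by
  refine (tsupport_comp_subset_preimage φ (f := fun y => x - y) (by fun_prop)).trans fun y hy => ?_
  simpa [dist_eq_norm, norm_sub_rev] using hφ hy

theorem fderiv_comp_const_sub_apply {V : Type*} [NormedAddCommGroup V] [NormedSpace ℝ V]
    {φ : V → ℝ} (hφ : Differentiable ℝ φ) (x y v : V) :
    fderiv ℝ (fun y => φ (x - y)) y v = -fderiv ℝ φ (x - y) v := by
  have hasFDerivAt_comp : HasFDerivAt (fun y => φ (x - y)) _ y :=
    (hφ (x - y)).hasFDerivAt.comp y ((hasFDerivAt_const x y).sub (hasFDerivAt_id y))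
  rw [hasFDerivAt_comp.fderiv]
  simp

theorem exists_contDiffBump_seq_rOut_le {V : Type*} [NormedAddCommGroup V] {η : ℝ}
    (hη : 0 < η) : ∃ φ : ℕ → ContDiffBump (0 : V), Tendsto (fun k => (φ k).rOut) atTop (𝓝 0) ∧
      (∀ k, (φ k).rOut ≤ 2 * (φ k).rIn) ∧ ∀ k, (φ k).rOut ≤ η := by
  refine ⟨fun k => ⟨η / (k + 1) / 2, η / (k + 1), by positivity, half_lt_self (by positivity)⟩,
    ?_, fun k => ?_, fun k => ?_⟩
  · simpa [div_eq_mul_inv] using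
      (tendsto_one_div_add_atTop_nhds_zero_nat (𝕜 := ℝ)).const_mul η
  · exact (mul_div_cancel₀ (η / (k + 1)) two_ne_zero).ge
  · exact div_le_self hη.le (by linarith [(k.cast_nonneg : (0 : ℝ) ≤ k)])

variable {n : ℕ} {D K : Set (EuclideanSpace ℝ (Fin n))} {u : EuclideanSpace ℝ (Fin n) → ℝ}
  {G : EuclideanSpace ℝ (Fin n) → EuclideanSpace ℝ (Fin n)}

namespace HasWeakGradientOn

theorem integrable_indicator (h : HasWeakGradientOn u G D) (hK : IsCompact K) (hKD : K ⊆ D) :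
    Integrable (K.indicator u) :=
  (h.locallyIntegrableOn.integrableOn_compact_subset hKD hK).integrable_indicator hK.measurableSet

theorem integrable_indicator_gradient (h : HasWeakGradientOn u G D) (hK : IsCompact K)
    (hKD : K ⊆ D) : Integrable (K.indicator G) :=
  (h.locallyIntegrableOn_gradient.integrableOn_compact_subset hKD hK).integrable_indicator
    hK.measurableSet

theorem integral_fderiv_comp_const_sub (h : HasWeakGradientOn u G D) (hD : MeasurableSet D)
    (hK : IsCompact K) (hKD : K ⊆ D) {φ : EuclideanSpace ℝ (Fin n) → ℝ} (hφ : ContDiff ℝ ∞ φ)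
    {ρ : ℝ} (hφρ : tsupport φ ⊆ Metric.closedBall 0 ρ) {x : EuclideanSpace ℝ (Fin n)}
    (hx : Metric.closedBall x ρ ⊆ K) (v : EuclideanSpace ℝ (Fin n)) :
    ∫ y, fderiv ℝ φ (x - y) v * K.indicator u y
      = ∫ y, inner ℝ v (φ (x - y) • K.indicator G y) := by
  set ψ : EuclideanSpace ℝ (Fin n) → ℝ := fun y => φ (x - y)
  have hψx : tsupport ψ ⊆ Metric.closedBall x ρ := tsupport_comp_const_sub_subset hφρ x
  have hψ_eq_zero (y) (hy : y ∉ K) : ψ y = 0 :=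
    image_eq_zero_of_notMem_tsupport fun hyψ => hy (hx (hψx hyψ))
  have hfderiv_eq_zero (y) (hy : y ∉ K) : fderiv ℝ ψ y = 0 :=
    image_eq_zero_of_notMem_tsupport fun hyψ => hy (hx (hψx (tsupport_fderiv_subset ℝ hyψ)))
  have hparts := h.integral_eq ψ (hφ.comp (contDiff_const.sub contDiff_id))
    ((isCompact_closedBall x ρ).of_isClosed_subset (isClosed_tsupport _) hψx)
    (hψx.trans (hx.trans hKD)) v
  rw [setIntegral_eq_of_subset_of_forall_sdiff_eq_zero hD hKD
      fun y hy => by simp [hfderiv_eq_zero y hy.2],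
    setIntegral_eq_of_subset_of_forall_sdiff_eq_zero hD hKD
      fun y hy => by simp [hψ_eq_zero y hy.2],
    ← integral_indicator hK.measurableSet, ← integral_indicator hK.measurableSet] at hparts
  calc ∫ y, fderiv ℝ φ (x - y) v * K.indicator u y
      = -∫ y, K.indicator (fun y => u y * fderiv ℝ ψ y v) y := by
        rw [← integral_neg]
        congr! 2 with y
        by_cases hy : y ∈ K
        · simp [hy, ψ, fderiv_comp_const_sub_apply (hφ.differentiable (by simp)), mul_comm]
        · simp [hy]
    _ = ∫ y, K.indicator (fun y => inner ℝ (G y) v * ψ y) y := by rw [hparts, neg_neg]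
    _ = ∫ y, inner ℝ v (φ (x - y) • K.indicator G y) := by
        congr! 2 with y
        by_cases hy : y ∈ K
        · simp [hy, ψ, inner_smul_right, real_inner_comm, mul_comm]
        · simp [hy]

theorem fderiv_convolution (h : HasWeakGradientOn u G D) (hD : MeasurableSet D)
    (hK : IsCompact K) (hKD : K ⊆ D) {φ : EuclideanSpace ℝ (Fin n) → ℝ} (hφ : ContDiff ℝ ∞ φ)
    {ρ : ℝ} (hφρ : tsupport φ ⊆ Metric.closedBall 0 ρ) {x : EuclideanSpace ℝ (Fin n)}
    (hx : Metric.closedBall x ρ ⊆ K) :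
    fderiv ℝ (φ ⋆[ContinuousLinearMap.lsmul ℝ ℝ, volume] K.indicator u) x
      = innerSL ℝ ((φ ⋆[ContinuousLinearMap.lsmul ℝ ℝ, volume] K.indicator G) x) := by
  have hu := (h.integrable_indicator hK hKD).locallyIntegrable
  have hG := (h.integrable_indicator_gradient hK hKD).locallyIntegrable
  have hφ1 : ContDiff ℝ 1 φ := hφ.of_le (by simp)
  have hφc : HasCompactSupport φ :=
    (isCompact_closedBall 0 ρ).of_isClosed_subset (isClosed_tsupport _) hφρ
  have hintegrable_gradient : Integrable fun y => φ (x - y) • K.indicator G y :=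
    (hφc.convolutionExists_left (ContinuousLinearMap.lsmul ℝ ℝ) hφ.continuous hG x).integrable_swap
  have hintegrable_fderiv : Integrable fun y => (ContinuousLinearMap.lsmul ℝ ℝ).precompL
      (EuclideanSpace ℝ (Fin n)) (fderiv ℝ φ (x - y)) (K.indicator u y) :=
    ((hφc.fderiv ℝ).convolutionExists_left _ (hφ1.continuous_fderiv one_ne_zero) hu
      x).integrable_swap
  rw [(hφc.hasFDerivAt_convolution_left _ hφ1 hu x).fderiv]
  ext v
  rw [convolution_eq_swap, ContinuousLinearMap.integral_apply hintegrable_fderiv,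
    innerSL_apply_apply, convolution_eq_swap, real_inner_comm]
  simp only [ContinuousLinearMap.precompL_apply, ContinuousLinearMap.lsmul_apply, smul_eq_mul]
  rw [h.integral_fderiv_comp_const_sub hD hK hKD hφ hφρ hx, integral_inner hintegrable_gradient]

theorem exists_contDiff_tendsto (h : HasWeakGradientOn u G D) (hD : IsOpen D) (hK : IsCompact K)
    (hKD : K ⊆ D) : ∃ f : ℕ → EuclideanSpace ℝ (Fin n) → ℝ, (∀ k, ContDiff ℝ 1 (f k)) ∧
      (∀ᵐ x ∂volume.restrict K, Tendsto (fun k => f k x) atTop (𝓝 (u x))) ∧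
      Tendsto (fun k => ∫⁻ x in K, ‖fderiv ℝ (f k) x - innerSL ℝ (G x)‖ₑ) atTop (𝓝 0) := by
  obtain ⟨η, hη, hηD⟩ := hK.exists_cthickening_subset_open hD hKD
  set K' := Metric.cthickening η K
  have hK' : IsCompact K' := hK.cthickening
  have hKK' : K ⊆ K' := Metric.self_subset_cthickening K
  have hu := (h.integrable_indicator hK' hηD).locallyIntegrable
  obtain ⟨φ, hφ0, hφ2, hφη⟩ :=
    exists_contDiffBump_seq_rOut_le (V := EuclideanSpace ℝ (Fin n)) hη
  refine ⟨fun k => (φ k).normed volume ⋆[ContinuousLinearMap.lsmul ℝ ℝ, volume] K'.indicator u,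
    fun k => (φ k).hasCompactSupport_normed.contDiff_convolution_left _ (φ k).contDiff_normed hu,
    ?_, ?_⟩
  · filter_upwards [ae_restrict_of_ae
      (ContDiffBump.ae_convolution_tendsto_right_of_locallyIntegrable hφ0
        (Eventually.of_forall hφ2) hu), ae_restrict_mem hK.measurableSet] with x hx hxK
    simpa [hKK' hxK] using hx
  · refine tendsto_of_tendsto_of_tendsto_of_le_of_le tendsto_const_nhds
      (tendsto_lintegral_enorm_convolution_sub hφ0 (Eventually.of_forall hφ2)
        (h.integrable_indicator_gradient hK' hηD)) (fun _ => zero_le) fun k => ?_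
    refine (setLIntegral_mono' hK.measurableSet fun x hx => ?_).trans
      (setLIntegral_le_lintegral K _)
    have hxK' : Metric.closedBall x (φ k).rOut ⊆ K' :=
      (Metric.closedBall_subset_closedBall (hφη k)).trans
        (Metric.closedBall_subset_cthickening hx η)
    rw [h.fderiv_convolution hD.measurableSet hK' hηD (φ k).contDiff_normed
      (φ k).tsupport_normed_eq.subset hxK', ← map_sub, indicator_of_mem (hKK' hx),
      ← ofReal_norm, innerSL_apply_norm, ofReal_norm]

theorem lintegral_lintegral_enorm_comp_sub_le (h : HasWeakGradientOn u G D) (hD : IsOpen D)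
    {z : EuclideanSpace ℝ (Fin n)} {r : ℝ} (hr : Metric.closedBall z r ⊆ D) {Φ : ℝ → ℝ}
    (hΦ : ContDiff ℝ 1 Φ) {M : ℝ≥0} (hM : ∀ t, ‖deriv Φ t‖ₑ ≤ M) :
    ∫⁻ x in Metric.ball z r, ∫⁻ y in Metric.ball z r, ‖Φ (u x) - Φ (u y)‖ₑ
      ≤ 2 ^ (n + 1) * ENNReal.ofReal r * volume (Metric.ball z r)
        * ∫⁻ y in Metric.ball z r, ‖deriv Φ (u y)‖ₑ * ‖G y‖ₑ := by
  obtain ⟨f, hf, hlim, hlim'⟩ := h.exists_contDiff_tendsto hD (isCompact_closedBall z r) hr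
  have hball : volume.restrict (Metric.ball z r) ≤ volume.restrict (Metric.closedBall z r) :=
    Measure.restrict_mono Metric.ball_subset_closedBall le_rfl
  replace hlim := hlim.filter_mono (ae_mono hball)
  replace hlim' := tendsto_of_tendsto_of_tendsto_of_le_of_le tendsto_const_nhds hlim'
    (fun _ => zero_le) fun k => lintegral_mono' hball le_rfl
  have hG : IntegrableOn (fun x => innerSL ℝ (G x)) (Metric.ball z r) :=
    (innerSL ℝ).integrable_comp ((h.locallyIntegrableOn_gradient.integrableOn_compact_subset hr
      (isCompact_closedBall z r)).mono_set Metric.ball_subset_closedBall)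
  set C : ℝ≥0∞ := 2 ^ (n + 1) * ENNReal.ofReal r * volume (Metric.ball z r)
  have hC : C ≠ ⊤ := by
    have := (measure_ball_lt_top (μ := volume) (x := z) (r := r)).ne
    finiteness
  calc ∫⁻ x in Metric.ball z r, ∫⁻ y in Metric.ball z r, ‖Φ (u x) - Φ (u y)‖ₑ
      ≤ liminf (fun k => ∫⁻ x in Metric.ball z r, ∫⁻ y in Metric.ball z r,
          ‖Φ (f k x) - Φ (f k y)‖ₑ) atTop :=
        lintegral_lintegral_enorm_sub_le_liminf (f := fun k => Φ ∘ f k) (g := Φ ∘ u)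
          (fun k => (hΦ.continuous.comp (hf k).continuous).measurable)
          (hlim.mono fun x hx => (hΦ.continuous.tendsto _).comp hx)
    _ ≤ liminf (fun k => C * ∫⁻ x in Metric.ball z r, ‖fderiv ℝ (Φ ∘ f k) x‖ₑ) atTop := by
        refine liminf_le_liminf (Eventually.of_forall fun k => ?_)
        have := lintegral_lintegral_enorm_sub_le_of_contDiff (μ := volume) (hΦ.comp (hf k)) z r
        rwa [finrank_euclideanSpace_fin] at this
    _ ≤ C * ∫⁻ y in Metric.ball z r, ‖deriv Φ (u y)‖ₑ * ‖innerSL ℝ (G y)‖ₑ := by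
        rw [ENNReal.liminf_const_mul_of_ne_top hC]
        gcongr
        exact liminf_lintegral_enorm_fderiv_comp_le hf hG hlim hlim' hΦ hM
    _ = C * ∫⁻ y in Metric.ball z r, ‖deriv Φ (u y)‖ₑ * ‖G y‖ₑ := by
        simp_rw [← ofReal_norm, innerSL_apply_norm]

end HasWeakGradientOn

end WeakPoincare

/-! ### Chains of balls -/

section Chains

open Metric

theorem ball_infDist_frontier_subset {V : Type*} [NormedAddCommGroup V] [NormedSpace ℝ V]
    {D : Set V} (hD : IsOpen D) {x : V} (hx : x ∈ D) : ball x (infDist x (frontier D)) ⊆ D := by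
  rcases le_or_gt (infDist x (frontier D)) 0 with h0 | h0
  · exact (ball_eq_empty.2 h0).trans_subset (empty_subset _)
  have hcov : ball x (infDist x (frontier D)) ⊆ D ∪ (closure D)ᶜ := by
    intro y hy
    by_contra! hcon
    rw [mem_union, not_or, notMem_compl_iff] at hcon
    have hyf : y ∈ frontier D := hD.frontier_eq ▸ ⟨hcon.2, hcon.1⟩
    exact absurd (mem_ball'.1 hy) (not_lt.2 (infDist_le_dist_of_mem hyf))
  exact (convex_ball x _).isPreconnected.subset_left_of_subset_union hD
    isClosed_closure.isOpen_compl (disjoint_compl_right.mono_left subset_closure) hcov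
    ⟨x, mem_ball_self h0, hx⟩

theorem lipschitzOnWith_one_of_hasUnitSpeedOn {X : Type*} [PseudoMetricSpace X] {γ : ℝ → X}
    {S : Set ℝ} (h : HasUnitSpeedOn γ S) : LipschitzOnWith 1 γ S := by
  refine LipschitzOnWith.of_dist_le_mul fun a ha b hb => ?_
  wlog hab : a ≤ b generalizing a b
  · simpa only [dist_comm] using this b hb a ha (le_of_not_ge hab)
  have hvar := eVariationOn.edist_le γ (s := S ∩ Icc a b) ⟨ha, le_rfl, hab⟩ ⟨hb, hab, le_rfl⟩
  rwa [h ha hb, edist_dist, ENNReal.ofReal_le_ofReal_iff (by simpa using hab),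
    ← abs_of_nonneg (sub_nonneg.2 hab), ← Real.dist_eq, dist_comm b] at hvar

section LastExit

variable {X : Type*} [PseudoMetricSpace X] {γ : ℝ → X} {ℓ r a b : ℝ}

/-- The last time in `[0, ℓ]` at which the curve `γ` is within distance `r` of `γ a`. -/
noncomputable def lastTimeNear (γ : ℝ → X) (ℓ r a : ℝ) : ℝ :=
  sSup {b ∈ Icc 0 ℓ | dist (γ b) (γ a) ≤ r}

theorem lastTimeNear_mem (hγ : ContinuousOn γ (Icc 0 ℓ)) (ha : a ∈ Icc 0 ℓ) (hr : 0 ≤ r) :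
    lastTimeNear γ ℓ r a ∈ {b ∈ Icc 0 ℓ | dist (γ b) (γ a) ≤ r} := by
  have hclosed : IsClosed {b ∈ Icc 0 ℓ | dist (γ b) (γ a) ≤ r} :=
    (continuous_dist.comp_continuousOn (hγ.prodMk continuousOn_const)).preimage_isClosed_of_isClosed
      isClosed_Icc isClosed_Iic
  refine (isCompact_Icc.of_isClosed_subset hclosed (sep_subset _ _)).sSup_mem ⟨a, ha, ?_⟩
  rwa [dist_self]

theorem le_lastTimeNear (hb : b ∈ Icc 0 ℓ) (h : dist (γ b) (γ a) ≤ r) :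
    b ≤ lastTimeNear γ ℓ r a :=
  le_csSup ⟨ℓ, fun _ hc => hc.1.2⟩ ⟨hb, h⟩

theorem min_add_le_lastTimeNear (hγ : LipschitzOnWith 1 γ (Icc 0 ℓ)) (ha : a ∈ Icc 0 ℓ)
    (hr : 0 ≤ r) : min ℓ (a + r) ≤ lastTimeNear γ ℓ r a := by
  have ham : a ≤ min ℓ (a + r) := le_min ha.2 (le_add_of_nonneg_right hr)
  have hmem : min ℓ (a + r) ∈ Icc 0 ℓ := ⟨ha.1.trans ham, min_le_left _ _⟩
  refine le_lastTimeNear hmem ((hγ.dist_le_mul _ hmem _ ha).trans ?_)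
  rw [NNReal.coe_one, one_mul, Real.dist_eq, abs_of_nonneg (sub_nonneg.2 ham)]
  linarith [min_le_right ℓ (a + r)]

theorem le_dist_of_lastTimeNear_le (hγ : LipschitzOnWith 1 γ (Icc 0 ℓ)) (hb : b ∈ Icc 0 ℓ)
    (hbℓ : b < ℓ) (h : lastTimeNear γ ℓ r a ≤ b) : r ≤ dist (γ b) (γ a) := by
  by_contra! hlt
  set b' := min ℓ (b + (r - dist (γ b) (γ a)))
  have hbb' : b < b' := lt_min hbℓ (by linarith)
  have hb' : b' ∈ Icc 0 ℓ := ⟨hb.1.trans hbb'.le, min_le_left _ _⟩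
  have hnear : dist (γ b') (γ a) ≤ r := by
    have hstep := hγ.dist_le_mul _ hb' _ hb
    rw [NNReal.coe_one, one_mul, Real.dist_eq, abs_of_pos (sub_pos.2 hbb')] at hstep
    linarith [dist_triangle (γ b') (γ b) (γ a), min_le_right ℓ (b + (r - dist (γ b) (γ a)))]
  linarith [le_lastTimeNear hb' hnear]

theorem exists_lastExit_chain (hℓ : 0 ≤ ℓ) (hγ : LipschitzOnWith 1 γ (Icc 0 ℓ)) {ρ : ℝ → ℝ}
    {ε : ℝ} (hε : 0 < ε) (hρ : ∀ t ∈ Icc 0 ℓ, ε ≤ ρ t) :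
    ∃ (N : ℕ) (t : ℕ → ℝ), (∀ i, t i ∈ Icc 0 ℓ) ∧ t 0 = 0 ∧ t N = ℓ ∧
      (∀ i, dist (γ (t (i + 1))) (γ (t i)) ≤ ρ (t i)) ∧
      ∀ i j, i < j → j < N → ρ (t i) ≤ dist (γ (t j)) (γ (t i)) := by
  classical
  set next : ℝ → ℝ := fun a => lastTimeNear γ ℓ (ρ a) a
  set t : ℕ → ℝ := fun i => next^[i] 0 with ht
  have hnext : ∀ i, t (i + 1) = next (t i) := fun i => Function.iterate_succ_apply' next i 0
  have hmem : ∀ a ∈ Icc 0 ℓ, next a ∈ {b ∈ Icc 0 ℓ | dist (γ b) (γ a) ≤ ρ a} := fun a ha =>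
    lastTimeNear_mem hγ.continuousOn ha (hε.le.trans (hρ a ha))
  have htI : ∀ i, t i ∈ Icc 0 ℓ := by
    intro i
    induction i with
    | zero => exact ⟨le_rfl, hℓ⟩
    | succ i ih => exact hnext i ▸ (hmem _ ih).1
  have hgrow : ∀ i, min ℓ (t i + ε) ≤ t (i + 1) := fun i =>
    (min_le_min_left _ (add_le_add_right (hρ _ (htI i)) _)).trans <|
      hnext i ▸ min_add_le_lastTimeNear hγ (htI i) (hε.le.trans (hρ _ (htI i)))
  have hmono : Monotone t := monotone_nat_of_le_succ fun i =>
    (le_min (htI i).2 (le_add_of_nonneg_right hε.le)).trans (hgrow i)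
  have hlin : ∀ i : ℕ, min ℓ (i * ε) ≤ t i := by
    intro i
    induction i with
    | zero => simp [ht, hℓ]
    | succ i ih =>
      refine le_trans (le_min (min_le_left _ _) ?_) (hgrow i)
      rw [min_le_iff] at ih ⊢
      push_cast
      exact ih.imp (fun h => by linarith) fun h => by linarith
  have hend : ∃ N, t N = ℓ := by
    obtain ⟨N, hN⟩ := exists_nat_ge (ℓ / ε)
    refine ⟨N, le_antisymm (htI N).2 ?_⟩
    simpa [min_eq_left ((div_le_iff₀ hε).1 hN)] using hlin N
  refine ⟨Nat.find hend, t, htI, rfl, Nat.find_spec hend, fun i => ?_, fun i j hij hj => ?_⟩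
  · exact hnext i ▸ (hmem _ (htI i)).2
  · exact le_dist_of_lastTimeNear_le hγ (htI j) ((htI j).2.lt_of_ne (Nat.find_min hend hj))
      ((hnext i).symm.trans_le (hmono (Nat.succ_le_of_lt hij)))

end LastExit

section Overlap

variable {V : Type*} [NormedAddCommGroup V] [NormedSpace ℝ V] [FiniteDimensional ℝ V]

theorem card_mul_pow_le_of_separated {ι : Type*} (I : Finset ι) (p : ι → V) (y : V) {ε R : ℝ}
    (hε : 0 < ε) (hR : 0 ≤ R) (hsep : ∀ i ∈ I, ∀ j ∈ I, i ≠ j → 2 * ε ≤ dist (p i) (p j))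
    (hp : ∀ i ∈ I, dist (p i) y ≤ R) :
    (I.card : ℝ) * ε ^ Module.finrank ℝ V ≤ (R + ε) ^ Module.finrank ℝ V := by
  borelize V
  let μ : Measure V := Measure.addHaar
  have hdisj : (I : Set ι).PairwiseDisjoint fun i => ball (p i) ε := fun i hi j hj hij =>
    ball_disjoint_ball (by linarith [hsep i hi j hj hij])
  have hsub : ⋃ i ∈ I, ball (p i) ε ⊆ ball y (R + ε) :=
    iUnion₂_subset fun i hi => ball_subset_ball' (by linarith [hp i hi])
  have hvol : ∑ i ∈ I, μ (ball (p i) ε) ≤ μ (ball y (R + ε)) := by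
    rw [← measure_biUnion_finset hdisj fun i _ => measurableSet_ball]
    exact measure_mono hsub
  simp_rw [Measure.addHaar_ball_of_pos μ _ hε,
    Measure.addHaar_ball_of_pos μ y (by linarith : 0 < R + ε)] at hvol
  rwa [Finset.sum_const, nsmul_eq_mul, ← mul_assoc,
    ENNReal.mul_le_mul_iff_left (measure_ball_pos μ _ one_pos).ne' measure_ball_lt_top.ne,
    ← ENNReal.ofReal_natCast, ← ENNReal.ofReal_mul (by positivity),
    ENNReal.ofReal_le_ofReal_iff (by positivity)] at hvol

theorem card_le_of_mem_ball_of_separated {d : V → ℝ} (hd : LipschitzWith 1 d) {N : ℕ} {p : ℕ → V}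
    (hpos : ∀ i, 0 < d (p i))
    (hsep : ∀ i j, i < j → j < N → d (p i) / 4 ≤ dist (p j) (p i)) {y : V} {I : Finset ℕ}
    (hIN : ∀ i ∈ I, i < N) (hIy : ∀ i ∈ I, y ∈ ball (p i) (3 / 4 * d (p i))) :
    I.card ≤ 43 ^ Module.finrank ℝ V := by
  rcases I.eq_empty_or_nonempty with rfl | ⟨i₀, hi₀⟩
  · simp
  have hcomp : ∀ i ∈ I, 4 / 7 * d y ≤ d (p i) ∧ d (p i) ≤ 4 * d y := fun i hi => by
    have hdist := (hd.dist_le_mul y (p i)).trans_lt (by simpa using hIy i hi)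
    rw [Real.dist_eq, abs_lt] at hdist
    constructor <;> linarith [hdist.1, hdist.2]
  have hdy : 0 < d y := by linarith [(hcomp i₀ hi₀).2, hpos i₀]
  have hsep' : ∀ i ∈ I, ∀ j ∈ I, i ≠ j → 2 * (d y / 14) ≤ dist (p i) (p j) := by
    intro i hi j hj hij
    wlog hlt : i < j generalizing i j
    · rw [dist_comm]
      exact this j hj i hi hij.symm (lt_of_le_of_ne (not_lt.1 hlt) hij.symm)
    rw [dist_comm]
    linarith [hsep i j hlt (hIN j hj), (hcomp i hi).1]
  have key := card_mul_pow_le_of_separated I p y (R := 3 * d y) (by positivity) (by positivity)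
    hsep' fun i hi => by linarith [mem_ball'.1 (hIy i hi), (hcomp i hi).2]
  rw [show 3 * d y + d y / 14 = 43 * (d y / 14) by ring, mul_pow] at key
  exact_mod_cast le_of_mul_le_mul_right key (by positivity)

end Overlap

theorem sum_indicator_dyadic_le {r ρ : ℝ} (hr : 0 < r) (hρ : 0 < ρ) {m : ℕ} (hm : m ≠ 0)
    (K : ℕ) :
    ∑ k ∈ Finset.range K, (if r < ρ / 2 ^ k then ((ρ / 2 ^ k) ^ m)⁻¹ else 0) ≤ 2 * (r ^ m)⁻¹ := by
  -- The terms grow geometrically, so the sum is also at most the next term.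
  suffices h : ∑ k ∈ Finset.range K, (if r < ρ / 2 ^ k then ((ρ / 2 ^ k) ^ m)⁻¹ else 0)
      ≤ min (2 * (r ^ m)⁻¹) ((ρ / 2 ^ K) ^ m)⁻¹ from h.trans (min_le_left _ _)
  rw [le_min_iff]
  induction K with
  | zero => constructor <;> (rw [Finset.sum_range_zero]; positivity)
  | succ K ih =>
    have hdouble : 2 * ((ρ / 2 ^ K) ^ m)⁻¹ ≤ ((ρ / 2 ^ (K + 1)) ^ m)⁻¹ := by
      rw [pow_succ, ← div_div, div_pow _ (2 : ℝ), inv_div, div_eq_mul_inv]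
      exact mul_le_mul_of_nonneg_right (le_self_pow₀ one_le_two hm) (by positivity)
    have hpos : 0 ≤ ((ρ / 2 ^ K) ^ m)⁻¹ := by positivity
    rw [Finset.sum_range_succ]
    split_ifs with h
    · have : ((ρ / 2 ^ K) ^ m)⁻¹ ≤ (r ^ m)⁻¹ := by gcongr
      constructor <;> linarith [ih.2]
    · constructor <;> linarith [ih.1, ih.2]

end Chains

/-! ### Comparison of averages -/

section Averages

variable {Ω : Type*} [MeasurableSpace Ω] {μ : Measure Ω}

theorem enorm_setAverage_sub_le {A : Set Ω} {v : Ω → ℝ} (h0 : μ A ≠ 0) (ht : μ A ≠ ⊤)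
    (hv : IntegrableOn v A μ) (c : ℝ) :
    ‖(⨍ x in A, v x ∂μ) - c‖ₑ ≤ (μ A)⁻¹ * ∫⁻ x in A, ‖v x - c‖ₑ ∂μ := by
  have hpos : 0 < μ.real A := ENNReal.toReal_pos h0 ht
  have hsub : (⨍ x in A, v x ∂μ) - c = (μ.real A)⁻¹ • ∫ x in A, (v x - c) ∂μ := by
    rw [integral_sub hv (integrableOn_const ht), setAverage_eq, setIntegral_const, smul_sub,
      inv_smul_smul₀ hpos.ne']
  rw [hsub, enorm_smul, enorm_inv hpos.ne', Real.enorm_eq_ofReal hpos.le, ofReal_measureReal ht]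
  gcongr
  exact enorm_integral_le_lintegral_enorm _

theorem enorm_setAverage_sub_setAverage_le {A B S : Set Ω} {v : Ω → ℝ} (hAS : A ⊆ S)
    (hBS : B ⊆ S) (hA0 : μ A ≠ 0) (hB0 : μ B ≠ 0) (hS : μ S ≠ ⊤) (hv : IntegrableOn v S μ) :
    ‖(⨍ x in A, v x ∂μ) - ⨍ x in B, v x ∂μ‖ₑ
      ≤ (μ A)⁻¹ * ((μ B)⁻¹ * ∫⁻ x in S, ∫⁻ y in S, ‖v x - v y‖ₑ ∂μ ∂μ) := by
  have hAt : μ A ≠ ⊤ := ((measure_mono hAS).trans_lt hS.lt_top).ne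
  have hBt : μ B ≠ ⊤ := ((measure_mono hBS).trans_lt hS.lt_top).ne
  refine (enorm_setAverage_sub_le hA0 hAt (hv.mono_set hAS) _).trans ?_
  gcongr
  calc ∫⁻ x in A, ‖v x - ⨍ y in B, v y ∂μ‖ₑ ∂μ
      ≤ ∫⁻ x in S, (μ B)⁻¹ * ∫⁻ y in S, ‖v x - v y‖ₑ ∂μ ∂μ := by
        refine (lintegral_mono_set hAS).trans (lintegral_mono fun x => ?_)
        rw [enorm_sub_rev]
        refine (enorm_setAverage_sub_le hB0 hBt (hv.mono_set hBS) _).trans ?_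
        simp_rw [enorm_sub_rev (v x)]
        gcongr
    _ = _ := lintegral_const_mul' _ _ (ENNReal.inv_ne_top.2 hB0)

theorem sum_mul_setLIntegral_le {ι : Type*} {D : Set Ω} (I : Finset ι) {S : ι → Set Ω}
    (hS : ∀ i ∈ I, MeasurableSet (S i)) (hSD : ∀ i ∈ I, S i ⊆ D) (a : ι → ℝ≥0∞)
    {g k : Ω → ℝ≥0∞} (hg : AEMeasurable g (μ.restrict D))
    (h : ∀ᵐ y ∂μ.restrict D, ∑ i ∈ I, (S i).indicator (fun _ => a i) y ≤ k y) :
    ∑ i ∈ I, a i * ∫⁻ y in S i, g y ∂μ ≤ ∫⁻ y in D, g y * k y ∂μ := by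
  calc ∑ i ∈ I, a i * ∫⁻ y in S i, g y ∂μ
      = ∑ i ∈ I, ∫⁻ y in D, g y * (S i).indicator (fun _ => a i) y ∂μ := by
        refine Finset.sum_congr rfl fun i hi => ?_
        simp_rw [← indicator_mul_right, mul_comm (g _)]
        rw [setLIntegral_indicator (hS i hi), inter_eq_left.2 (hSD i hi),
          lintegral_const_mul'' _ (hg.mono_measure (Measure.restrict_mono (hSD i hi) le_rfl))]
    _ = ∫⁻ y in D, ∑ i ∈ I, g y * (S i).indicator (fun _ => a i) y ∂μ := by
        refine (lintegral_finsetSum' (f := fun i y => g y * (S i).indicator (fun _ => a i) y) _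
          fun i hi => ?_).symm
        exact hg.mul (measurable_const.indicator (hS i hi)).aemeasurable
    _ ≤ ∫⁻ y in D, g y * k y ∂μ := by
        refine lintegral_mono_ae (h.mono fun y hy => ?_)
        rw [← Finset.mul_sum]
        gcongr

end Averages

/-! ### The pointwise estimate on John domains -/

section Pointwise

open Filter Topology Metric

variable {n : ℕ} {D : Set (EuclideanSpace ℝ (Fin n))}

/-- `v` satisfies the Poincaré inequality with upper gradient `g` on all balls that are
compactly contained in `D`. -/
def HasBallPoincare (v : EuclideanSpace ℝ (Fin n) → ℝ) (g : EuclideanSpace ℝ (Fin n) → ℝ≥0∞)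
    (D : Set (EuclideanSpace ℝ (Fin n))) : Prop :=
  ∀ (z : EuclideanSpace ℝ (Fin n)) (r : ℝ), closedBall z r ⊆ D →
    ∫⁻ x in ball z r, ∫⁻ y in ball z r, ‖v x - v y‖ₑ
      ≤ 2 ^ (n + 1) * ENNReal.ofReal r * volume (ball z r) * ∫⁻ y in ball z r, g y

/-- The potential `x ↦ ∫ g(y) |x - y| ^ (-a(x)) dμ(y)` with variable exponent. -/
noncomputable def variableRieszPotential {X : Type*} [PseudoMetricSpace X] [MeasurableSpace X]
    (a : X → ℝ) (g : X → ℝ≥0∞) (μ : Measure X) (x : X) : ℝ≥0∞ :=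
  ∫⁻ y, g y * ENNReal.ofReal (dist x y ^ (-a x)) ∂μ

theorem lintegral_mul_ofReal_mul_rpow_dist {X : Type*} [PseudoMetricSpace X] [MeasurableSpace X]
    {μ : Measure X} (a : X → ℝ) (g : X → ℝ≥0∞) {c : ℝ} (hc : 0 ≤ c) (x : X) :
    ∫⁻ y, g y * ENNReal.ofReal (c * dist x y ^ (-a x)) ∂μ
      = ENNReal.ofReal c * variableRieszPotential a g μ x := by
  simp_rw [variableRieszPotential, ENNReal.ofReal_mul hc, mul_left_comm (g _)]
  exact lintegral_const_mul' _ _ ENNReal.ofReal_ne_top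

section Averages

variable {v : EuclideanSpace ℝ (Fin n) → ℝ} {g : EuclideanSpace ℝ (Fin n) → ℝ≥0∞}

theorem volume_real_unitBall_pos : 0 < volume.real (ball (0 : EuclideanSpace ℝ (Fin n)) 1) :=
  ENNReal.toReal_pos (measure_ball_pos _ _ one_pos).ne' measure_ball_lt_top.ne

theorem volume_ball_eq_ofReal (z : EuclideanSpace ℝ (Fin n)) {r : ℝ} (hr : 0 < r) :
    volume (ball z r)
      = ENNReal.ofReal (r ^ n * volume.real (ball (0 : EuclideanSpace ℝ (Fin n)) 1)) := by
  rw [Measure.addHaar_ball_of_pos _ _ hr, finrank_euclideanSpace_fin,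
    ENNReal.ofReal_mul (by positivity), ofReal_measureReal measure_ball_lt_top.ne]

/-- The constant in the comparison of the averages over two balls of radius at least `r / 4`
inside a ball of radius `r`. -/
noncomputable def averageConst (n : ℕ) : ℝ :=
  2 ^ (n + 1) * 16 ^ n / volume.real (ball (0 : EuclideanSpace ℝ (Fin n)) 1)

theorem averageConst_pos : 0 < averageConst n :=
  div_pos (by positivity) volume_real_unitBall_pos

theorem inv_volume_ball_sq_mul_eq (hn : n ≠ 0) {r : ℝ} (hr : 0 < r)
    (z : EuclideanSpace ℝ (Fin n)) :
    (volume (ball z (r / 4)))⁻¹ * ((volume (ball z (r / 4)))⁻¹ *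
        (2 ^ (n + 1) * ENNReal.ofReal r * volume (ball z r)))
      = ENNReal.ofReal (averageConst n) * ENNReal.ofReal ((r ^ (n - 1))⁻¹) := by
  have hω := volume_real_unitBall_pos (n := n)
  obtain ⟨m, rfl⟩ := Nat.exists_eq_succ_of_ne_zero hn
  have htwo : (2 : ℝ≥0∞) ^ (m.succ + 1) = ENNReal.ofReal (2 ^ (m.succ + 1)) := by
    rw [ENNReal.ofReal_pow two_pos.le, ENNReal.ofReal_ofNat]
  rw [volume_ball_eq_ofReal z hr, volume_ball_eq_ofReal z (by positivity : 0 < r / 4),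
    ← ENNReal.ofReal_inv_of_pos (by positivity), htwo, ← ENNReal.ofReal_mul (by positivity),
    ← ENNReal.ofReal_mul (by positivity), ← ENNReal.ofReal_mul (by positivity),
    ← ENNReal.ofReal_mul (by positivity), ← ENNReal.ofReal_mul averageConst_pos.le, averageConst,
    Nat.succ_eq_add_one, Nat.add_sub_cancel, div_pow,
    show (16 : ℝ) ^ (m + 1) = 4 ^ (m + 1) * 4 ^ (m + 1) by rw [← mul_pow]; norm_num]
  congr 1
  field_simp
  ring

namespace HasBallPoincare

theorem enorm_average_sub_average_le (hn : n ≠ 0) (h : HasBallPoincare v g D)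
    (hv : IntegrableOn v D) {z a b : EuclideanSpace ℝ (Fin n)} {r r₁ r₂ : ℝ} (hr : 0 < r)
    (hzD : closedBall z r ⊆ D) (hr₁ : r / 4 ≤ r₁) (hr₂ : r / 4 ≤ r₂)
    (ha : ball a r₁ ⊆ ball z r) (hb : ball b r₂ ⊆ ball z r) :
    ‖(⨍ x in ball a r₁, v x) - ⨍ x in ball b r₂, v x‖ₑ
      ≤ ENNReal.ofReal (averageConst n) *
        (ENNReal.ofReal ((r ^ (n - 1))⁻¹) * ∫⁻ y in ball z r, g y) := by
  have hinv : ∀ (c : EuclideanSpace ℝ (Fin n)) (r' : ℝ), r / 4 ≤ r' →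
      (volume (ball c r'))⁻¹ ≤ (volume (ball z (r / 4)))⁻¹ := fun c r' hr' => by
    rw [Measure.addHaar_ball_center volume c, Measure.addHaar_ball_center volume z]
    exact ENNReal.inv_le_inv.2 (measure_mono (ball_subset_ball hr'))
  calc ‖(⨍ x in ball a r₁, v x) - ⨍ x in ball b r₂, v x‖ₑ
      ≤ (volume (ball a r₁))⁻¹ * ((volume (ball b r₂))⁻¹ *
          ∫⁻ x in ball z r, ∫⁻ y in ball z r, ‖v x - v y‖ₑ) :=
        enorm_setAverage_sub_setAverage_le ha hb (measure_ball_pos _ _ (by linarith)).ne'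
          (measure_ball_pos _ _ (by linarith)).ne' measure_ball_lt_top.ne
          (hv.mono_set (ball_subset_closedBall.trans hzD))
    _ ≤ (volume (ball z (r / 4)))⁻¹ * ((volume (ball z (r / 4)))⁻¹ *
          (2 ^ (n + 1) * ENNReal.ofReal r * volume (ball z r) * ∫⁻ y in ball z r, g y)) :=
        mul_le_mul' (hinv _ _ hr₁) (mul_le_mul' (hinv _ _ hr₂) (h z r hzD))
    _ = _ := by
        rw [← mul_assoc (ENNReal.ofReal _), ← inv_volume_ball_sq_mul_eq hn hr z]
        ring

theorem enorm_average_sub_average_le_of_chain (hn : n ≠ 0) (h : HasBallPoincare v g D)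
    (hv : IntegrableOn v D) (hg : AEMeasurable g (volume.restrict D)) {N : ℕ}
    {p : ℕ → EuclideanSpace ℝ (Fin n)} {r R : ℕ → ℝ} (hR : ∀ i, 0 < R i)
    (hD : ∀ i, closedBall (p i) (R i) ⊆ D) (hRr : ∀ i, R i / 4 ≤ r i) (hrR : ∀ i, r i ≤ R i)
    (hRr' : ∀ i, R i / 4 ≤ r (i + 1)) (hstep : ∀ i, dist (p (i + 1)) (p i) + r (i + 1) ≤ R i)
    {k : EuclideanSpace ℝ (Fin n) → ℝ≥0∞}
    (hk : ∀ᵐ y ∂volume.restrict D, ∑ i ∈ Finset.range N, (ball (p i) (R i)).indicator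
      (fun _ => ENNReal.ofReal ((R i ^ (n - 1))⁻¹)) y ≤ k y) :
    ‖(⨍ y in ball (p 0) (r 0), v y) - ⨍ y in ball (p N) (r N), v y‖ₑ
      ≤ ENNReal.ofReal (averageConst n) * ∫⁻ y in D, g y * k y := by
  rw [← Finset.sum_range_sub' fun i => ⨍ y in ball (p i) (r i), v y]
  calc ‖∑ i ∈ Finset.range N, ((⨍ y in ball (p i) (r i), v y)
          - ⨍ y in ball (p (i + 1)) (r (i + 1)), v y)‖ₑ
      ≤ ∑ i ∈ Finset.range N, ‖(⨍ y in ball (p i) (r i), v y)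
          - ⨍ y in ball (p (i + 1)) (r (i + 1)), v y‖ₑ := enorm_sum_le _ _
    _ ≤ ∑ i ∈ Finset.range N, ENNReal.ofReal (averageConst n) *
          (ENNReal.ofReal ((R i ^ (n - 1))⁻¹) * ∫⁻ y in ball (p i) (R i), g y) :=
        Finset.sum_le_sum fun i _ => h.enorm_average_sub_average_le hn hv (hR i) (hD i) (hRr i)
          (hRr' i) (ball_subset_ball (hrR i))
          (ball_subset_ball' (by linarith [hstep i]))
    _ ≤ ENNReal.ofReal (averageConst n) * ∫⁻ y in D, g y * k y := by
        rw [← Finset.mul_sum]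
        gcongr
        exact sum_mul_setLIntegral_le _ (fun _ _ => measurableSet_ball)
          (fun i _ => ball_subset_closedBall.trans (hD i)) _ hg hk

theorem enorm_sub_average_le (hn : 2 ≤ n) (h : HasBallPoincare v g D) (hv : IntegrableOn v D)
    (hg : AEMeasurable g (volume.restrict D)) {x : EuclideanSpace ℝ (Fin n)} {ρ : ℝ} (hρ : 0 < ρ)
    (hxD : closedBall x ρ ⊆ D)
    (hlim : Tendsto (fun k : ℕ => ⨍ y in ball x (ρ / 2 ^ k), v y) atTop (𝓝 (v x))) :
    ‖v x - ⨍ y in ball x ρ, v y‖ₑ ≤ ENNReal.ofReal (averageConst n) *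
      ∫⁻ y in D, g y * ENNReal.ofReal (2 * (dist x y ^ (n - 1))⁻¹) := by
  have : NeZero n := ⟨by omega⟩
  refine le_of_tendsto ((hlim.sub_const _).enorm) (Eventually.of_forall fun K => ?_)
  have hR : ∀ k : ℕ, 0 < ρ / 2 ^ k := fun k => by positivity
  have hhalf : ∀ k : ℕ, ρ / 2 ^ (k + 1) = ρ / 2 ^ k / 2 := fun k => by rw [pow_succ, div_div]
  have hD : ∀ k : ℕ, closedBall x (ρ / 2 ^ k) ⊆ D := fun k =>
    (closedBall_subset_closedBall (div_le_self hρ.le (one_le_pow₀ one_le_two))).trans hxD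
  have hchain := h.enorm_average_sub_average_le_of_chain (N := K) (p := fun _ => x)
    (r := fun k => ρ / 2 ^ k) (R := fun k => ρ / 2 ^ k)
    (k := fun y => ENNReal.ofReal (2 * (dist x y ^ (n - 1))⁻¹)) (by omega) hv hg hR hD
    (fun k => by linarith [hR k]) (fun _ => le_rfl) (fun k => by linarith [hR k, hhalf k])
    (fun k => by rw [dist_self]; linarith [hR k, hhalf k]) ?_
  · rw [enorm_sub_rev]
    simpa only [pow_zero, div_one] using hchain
  filter_upwards [ae_restrict_of_ae (Measure.ae_ne volume x)] with y hy
  have hindicator : ∀ k ∈ Finset.range K, (ball x (ρ / 2 ^ k)).indicator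
      (fun _ => ENNReal.ofReal (((ρ / 2 ^ k) ^ (n - 1))⁻¹)) y
      = ENNReal.ofReal (if dist x y < ρ / 2 ^ k then ((ρ / 2 ^ k) ^ (n - 1))⁻¹ else 0) := by
    intro k _
    by_cases hd : dist x y < ρ / 2 ^ k <;> simp [indicator, dist_comm y x, hd]
  rw [Finset.sum_congr rfl hindicator, ← ENNReal.ofReal_sum_of_nonneg]
  · exact ENNReal.ofReal_le_ofReal
      (sum_indicator_dyadic_le (dist_pos.2 hy.symm) hρ (by omega) K)
  · intro k _
    split_ifs <;> positivity

end HasBallPoincare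

theorem ae_tendsto_average_ball [NeZero n] (hD : IsOpen D) (hv : IntegrableOn v D) :
    ∀ᵐ x ∂volume.restrict D, ∀ ρ > 0, closedBall x ρ ⊆ D →
      Tendsto (fun k : ℕ => ⨍ y in ball x (ρ / 2 ^ k), v y) atTop (𝓝 (v x)) := by
  have hlebesgue := IsUnifLocDoublingMeasure.ae_tendsto_average (μ := volume)
    (hv.integrable_indicator hD.measurableSet).locallyIntegrable 1
  filter_upwards [ae_restrict_of_ae hlebesgue, ae_restrict_mem hD.measurableSet]
    with x hx hxD ρ hρ hball
  have hradius : Tendsto (fun k : ℕ => ρ / 2 ^ k) atTop (𝓝[>] 0) := by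
    refine tendsto_nhdsWithin_iff.2
      ⟨?_, Eventually.of_forall fun k => mem_Ioi.2 (by positivity)⟩
    exact tendsto_const_nhds.div_atTop (tendsto_pow_atTop_atTop_of_one_lt one_lt_two)
  have hlim := hx (fun _ : ℕ => x) (fun k => ρ / 2 ^ k) hradius
    (Eventually.of_forall fun k => mem_closedBall_self (by positivity))
  rw [indicator_of_mem hxD] at hlim
  refine hlim.congr fun k => ?_
  have hball_ae : (ball x (ρ / 2 ^ k) : Set _) =ᵐ[volume] closedBall x (ρ / 2 ^ k) :=
    ae_eq_of_subset_of_measure_ge ball_subset_closedBall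
      (Measure.addHaar_closedBall_eq_addHaar_ball _ _ _).le
      measurableSet_ball.nullMeasurableSet measure_closedBall_lt_top.ne
  have hsub : ball x (ρ / 2 ^ k) ⊆ D := (ball_subset_closedBall.trans
    (closedBall_subset_closedBall (div_le_self hρ.le (one_le_pow₀ one_le_two)))).trans hball
  rw [← setAverage_congr hball_ae]
  exact setAverage_congr_fun measurableSet_ball
    (ae_of_all _ fun y hy => indicator_of_mem (hsub hy) v)

end Averages

section Kernel

theorem add_rpow_le_mul {t r B M σ : ℝ} (hr : 0 < r) (ht : 0 ≤ t) (hM : 1 ≤ M) (hσ : 1 ≤ σ)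
    (hσ2 : σ ≤ 2) (htr : t ^ σ ≤ B * r) (hrM : r ≤ M) : (t + r) ^ σ ≤ 4 * (B + M) * r := by
  have hrσ : r ^ σ ≤ M * r := by
    calc r ^ σ = r ^ (σ - 1) * r := by rw [← Real.rpow_add_one hr.ne', sub_add_cancel]
      _ ≤ M ^ (σ - 1) * r := by gcongr
      _ ≤ M ^ (1 : ℝ) * r := by gcongr; linarith
      _ = M * r := by rw [Real.rpow_one]
  have hmax : (max t r) ^ σ ≤ t ^ σ + r ^ σ := by
    have := Real.rpow_nonneg ht σ
    have := Real.rpow_nonneg hr.le σ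
    rcases max_cases t r with ⟨h, -⟩ | ⟨h, -⟩ <;> rw [h] <;> linarith
  calc (t + r) ^ σ ≤ (2 * max t r) ^ σ := by
        gcongr
        linarith [le_max_left t r, le_max_right t r]
    _ = 2 ^ σ * (max t r) ^ σ := Real.mul_rpow two_pos.le (le_max_of_le_left ht)
    _ ≤ 2 ^ (2 : ℝ) * (max t r) ^ σ := by gcongr; norm_num
    _ ≤ 2 ^ (2 : ℝ) * (t ^ σ + r ^ σ) := by gcongr
    _ ≤ 4 * (B + M) * r := by norm_num; linarith

theorem inv_pow_le_mul_rpow_neg {r t R B M σ : ℝ} (m : ℕ) (hr : 0 < r) (ht : 0 ≤ t) (hR : 0 < R)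
    (hM : 1 ≤ M) (hσ : 1 ≤ σ) (hσ2 : σ ≤ 2) (hRt : R ≤ t + r) (htr : t ^ σ ≤ B * r)
    (hrM : r ≤ M) : (r ^ m)⁻¹ ≤ (4 * (B + M)) ^ m * R ^ (-(σ * m)) := by
  have hRσ : R ^ σ ≤ 4 * (B + M) * r :=
    (Real.rpow_le_rpow hR.le hRt (by linarith)).trans (add_rpow_le_mul hr ht hM hσ hσ2 htr hrM)
  rw [Real.rpow_neg hR.le, Real.rpow_mul hR.le, Real.rpow_natCast, ← div_eq_mul_inv,
    inv_eq_one_div, div_le_div_iff₀ (by positivity) (by positivity), one_mul, ← mul_pow]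
  gcongr

theorem sum_indicator_ball_le_of_separated {V : Type*} [NormedAddCommGroup V] [NormedSpace ℝ V]
    [FiniteDimensional ℝ V] {d : V → ℝ} (hd : LipschitzWith 1 d) {N : ℕ} {p : ℕ → V}
    (hpos : ∀ i, 0 < d (p i))
    (hsep : ∀ i j, i < j → j < N → d (p i) / 4 ≤ dist (p j) (p i)) {w : ℕ → ℝ≥0∞} {b : ℝ≥0∞}
    {y : V} (hw : ∀ i, y ∈ ball (p i) (3 / 4 * d (p i)) → w i ≤ b) :
    ∑ i ∈ Finset.range N, (ball (p i) (3 / 4 * d (p i))).indicator (fun _ => w i) y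
      ≤ 43 ^ Module.finrank ℝ V * b := by
  classical
  set I : Finset ℕ := {i ∈ Finset.range N | y ∈ ball (p i) (3 / 4 * d (p i))} with hI
  have hcard : I.card ≤ 43 ^ Module.finrank ℝ V :=
    card_le_of_mem_ball_of_separated hd hpos hsep
      (fun _ hi => Finset.mem_range.1 (Finset.mem_filter.1 hi).1)
      (fun _ hi => (Finset.mem_filter.1 hi).2)
  calc ∑ i ∈ Finset.range N, (ball (p i) (3 / 4 * d (p i))).indicator (fun _ => w i) y
      = ∑ i ∈ I, w i := by simp_rw [hI, Finset.sum_filter, indicator_apply]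
    _ ≤ ∑ _ ∈ I, b := Finset.sum_le_sum fun i hi => hw i (Finset.mem_filter.1 hi).2
    _ = I.card * b := by rw [Finset.sum_const, nsmul_eq_mul]
    _ ≤ 43 ^ Module.finrank ℝ V * b := by gcongr; exact_mod_cast hcard

end Kernel

namespace IsJohnDomain

variable {s : EuclideanSpace ℝ (Fin n) → ℝ} {α β : ℝ} {x₀ x y : EuclideanSpace ℝ (Fin n)}
  {v : EuclideanSpace ℝ (Fin n) → ℝ} {g : EuclideanSpace ℝ (Fin n) → ℝ≥0∞}

theorem beta_pos (hJ : IsJohnDomain D s α β x₀) : 0 < β :=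
  hJ.alpha_pos.trans_le hJ.alpha_le_beta

theorem dist_center_le (hJ : IsJohnDomain D s α β x₀) (hx : x ∈ D) : dist x x₀ ≤ β := by
  obtain ⟨ℓ, γ, h0, hβ, hγ, -, rfl, rfl, -⟩ := hJ.exists_curve x hx
  have := (lipschitzOnWith_one_of_hasUnitSpeedOn hγ).dist_le_mul _ (left_mem_Icc.2 h0) _
    (right_mem_Icc.2 h0)
  rw [NNReal.coe_one, one_mul, dist_zero_left, Real.norm_of_nonneg h0] at this
  exact this.trans hβ

theorem dist_le (hJ : IsJohnDomain D s α β x₀) (hx : x ∈ D) (hy : y ∈ D) : dist x y ≤ 2 * β := by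
  linarith [dist_triangle_right x y x₀, hJ.dist_center_le hx, hJ.dist_center_le hy]

theorem frontier_nonempty [NeZero n] (hJ : IsJohnDomain D s α β x₀) : (frontier D).Nonempty := by
  refine nonempty_frontier_iff.2 ⟨hJ.isConnected.nonempty, fun h => ?_⟩
  exact NormedSpace.unbounded_univ ℝ (EuclideanSpace ℝ (Fin n)) (h ▸ hJ.isBounded)

theorem infDist_frontier_le [NeZero n] (hJ : IsJohnDomain D s α β x₀) (hx : x ∈ D) :
    infDist x (frontier D) ≤ 2 * β := by
  obtain ⟨y, hy⟩ := hJ.frontier_nonempty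
  have hyβ : y ∈ closedBall x₀ β :=
    closure_minimal (fun z hz => hJ.dist_center_le hz) isClosed_closedBall
      (frontier_subset_closure hy)
  linarith [infDist_le_dist_of_mem (x := x) hy, dist_triangle_right x y x₀, hJ.dist_center_le hx,
    mem_closedBall.1 hyβ]

theorem infDist_frontier_pos [NeZero n] (hJ : IsJohnDomain D s α β x₀) (hx : x ∈ D) :
    0 < infDist x (frontier D) := by
  refine (isClosed_frontier.notMem_iff_infDist_pos hJ.frontier_nonempty).1 fun h => ?_
  exact (hJ.isOpen.frontier_eq ▸ h).2 hx

theorem closedBall_subset [NeZero n] (hJ : IsJohnDomain D s α β x₀) (hx : x ∈ D) {c : ℝ}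
    (hc : c < 1) : closedBall x (c * infDist x (frontier D)) ⊆ D :=
  (closedBall_subset_ball (mul_lt_of_lt_one_left (hJ.infDist_frontier_pos hx) hc)).trans
    (ball_infDist_frontier_subset hJ.isOpen hx)

theorem exists_chain [NeZero n] (hJ : IsJohnDomain D s α β x₀) (hx : x ∈ D) :
    ∃ (N : ℕ) (p : ℕ → EuclideanSpace ℝ (Fin n)), p 0 = x ∧ p N = x₀ ∧ (∀ i, p i ∈ D) ∧
      (∀ i, dist (p (i + 1)) (p i) ≤ infDist (p i) (frontier D) / 4) ∧
      (∀ i j, i < j → j < N → infDist (p i) (frontier D) / 4 ≤ dist (p j) (p i)) ∧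
      ∀ i, dist x (p i) ^ s x ≤ β / α * infDist (p i) (frontier D) := by
  obtain ⟨ℓ, γ, h0, -, hγ, hγD, rfl, rfl, hcusp⟩ := hJ.exists_curve x hx
  have hLip := lipschitzOnWith_one_of_hasUnitSpeedOn hγ
  obtain ⟨τ, hτ, hmin⟩ := isCompact_Icc.exists_isMinOn ⟨0, left_mem_Icc.2 h0⟩
    ((continuous_infDist_pt (frontier D)).comp_continuousOn hLip.continuousOn)
  obtain ⟨N, t, htI, ht0, htN, hnext, hsep⟩ := exists_lastExit_chain h0 hLip
    (ρ := fun t => infDist (γ t) (frontier D) / 4) (ε := infDist (γ τ) (frontier D) / 4)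
    (div_pos (hJ.infDist_frontier_pos (hγD hτ)) four_pos)
    (fun t ht => div_le_div_of_nonneg_right (hmin ht) four_pos.le)
  refine ⟨N, γ ∘ t, congrArg γ ht0, congrArg γ htN, fun i => hγD (htI i), hnext, hsep,
    fun i => le_trans ?_ (hcusp (t i) (htI i))⟩
  have hdist := hLip.dist_le_mul _ (left_mem_Icc.2 h0) _ (htI i)
  rw [NNReal.coe_one, one_mul, dist_zero_left, Real.norm_of_nonneg (htI i).1] at hdist
  exact Real.rpow_le_rpow dist_nonneg hdist (zero_le_one.trans (hJ.one_le _ hx))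

/-- The constant in the comparison of `|x - y| ^ (-s(x) (n - 1))` with `r ^ (-(n - 1))`, where `r`
is the radius of a ball that contains `y` in the chain of balls from `x` to the John center. -/
noncomputable def kernelConst (n : ℕ) (α β : ℝ) : ℝ :=
  (4 * (2 * (β / α) + (1 + 2 * β))) ^ (n - 1)

theorem kernelConst_nonneg (hJ : IsJohnDomain D s α β x₀) : 0 ≤ kernelConst n α β := by
  have hα := hJ.alpha_pos
  have hβ := hJ.beta_pos
  unfold kernelConst
  positivity

theorem enorm_average_sub_average_center_le [NeZero n] (hJ : IsJohnDomain D s α β x₀)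
    (h : HasBallPoincare v g D) (hv : IntegrableOn v D) (hg : AEMeasurable g (volume.restrict D))
    (hx : x ∈ D) (hs : s x ≤ 2) :
    ‖(⨍ y in ball x (infDist x (frontier D) / 4), v y)
        - ⨍ y in ball x₀ (infDist x₀ (frontier D) / 4), v y‖ₑ
      ≤ ENNReal.ofReal (averageConst n) * ∫⁻ y in D, g y * ENNReal.ofReal
        (43 ^ n * kernelConst n α β * dist x y ^ (-(s x * (n - 1 : ℕ)))) := by
  obtain ⟨N, p, rfl, rfl, hpD, hnext, hsep, hcusp⟩ := hJ.exists_chain hx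
  have hd : LipschitzWith 1 fun y : EuclideanSpace ℝ (Fin n) => infDist y (frontier D) :=
    lipschitz_infDist_pt _
  have hpos : ∀ i, 0 < infDist (p i) (frontier D) := fun i => hJ.infDist_frontier_pos (hpD i)
  have hcomp : ∀ i, 3 / 4 * infDist (p i) (frontier D) ≤ infDist (p (i + 1)) (frontier D) ∧
      infDist (p (i + 1)) (frontier D) ≤ 5 / 4 * infDist (p i) (frontier D) := fun i => by
    have := (hd.dist_le_mul (p (i + 1)) (p i)).trans (by simpa using hnext i)
    rw [Real.dist_eq, abs_le] at this
    constructor <;> linarith [this.1, this.2]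
  refine h.enorm_average_sub_average_le_of_chain (p := p)
    (r := fun i => infDist (p i) (frontier D) / 4)
    (R := fun i => 3 / 4 * infDist (p i) (frontier D)) (NeZero.ne n) hv hg
    (fun i => by linarith [hpos i]) (fun i => hJ.closedBall_subset (hpD i) (by norm_num))
    (fun i => by linarith [hpos i]) (fun i => by linarith [hpos i])
    (fun i => by linarith [hpos i, hcomp i]) (fun i => by linarith [hpos i, hcomp i, hnext i]) ?_
  filter_upwards [ae_restrict_of_ae (Measure.ae_ne volume (p 0))] with y hy
  refine (sum_indicator_ball_le_of_separated hd hpos hsep (b := ENNReal.ofReal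
    (kernelConst n α β * dist (p 0) y ^ (-(s (p 0) * (n - 1 : ℕ))))) fun i hi => ?_).trans_eq ?_
  · refine ENNReal.ofReal_le_ofReal (inv_pow_le_mul_rpow_neg (t := dist (p 0) (p i)) (n - 1)
      (by linarith [hpos i]) dist_nonneg (dist_pos.2 hy.symm) (by linarith [hJ.beta_pos])
      (hJ.one_le _ hx) hs ?_ ?_ ?_)
    · linarith [dist_triangle_right (p 0) y (p i), mem_ball.1 hi]
    · linarith [hcusp i, Real.rpow_nonneg (dist_nonneg (x := p 0) (y := p i)) (s (p 0))]
    · linarith [hJ.infDist_frontier_le (hpD i), hpos i]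
  · rw [finrank_euclideanSpace_fin, mul_assoc, ENNReal.ofReal_mul (p := 43 ^ n) (by positivity),
      ENNReal.ofReal_pow (by norm_num), ENNReal.ofReal_ofNat]

theorem lintegral_mul_two_mul_inv_pow_le [NeZero n] (hJ : IsJohnDomain D s α β x₀) (hx : x ∈ D)
    (hs : s x ≤ 2) :
    ∫⁻ y in D, g y * ENNReal.ofReal (2 * (dist x y ^ (n - 1))⁻¹)
      ≤ ∫⁻ y in D, g y * ENNReal.ofReal
        (2 * kernelConst n α β * dist x y ^ (-(s x * (n - 1 : ℕ)))) := by
  have hα := hJ.alpha_pos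
  have hβ := hJ.beta_pos
  refine lintegral_mono_ae ?_
  filter_upwards [ae_restrict_of_ae (Measure.ae_ne volume x),
    ae_restrict_mem hJ.isOpen.measurableSet] with y hy hyD
  have hdist : 0 < dist x y := dist_pos.2 hy.symm
  rw [mul_assoc 2]
  gcongr
  refine inv_pow_le_mul_rpow_neg (t := 0) (n - 1) hdist le_rfl hdist (by linarith)
    (hJ.one_le _ hx) hs (by linarith) ?_ (by linarith [hJ.dist_le hx hyD])
  rw [Real.zero_rpow (by linarith [hJ.one_le _ hx])]
  positivity

/-- The constant in the pointwise estimate of a function by the potential of its gradient. -/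
noncomputable def potentialConst (n : ℕ) (α β : ℝ) : ℝ :=
  averageConst n * (2 * kernelConst n α β + 43 ^ n * kernelConst n α β)

theorem ae_enorm_sub_average_le (hn : 2 ≤ n) (hJ : IsJohnDomain D s α β x₀)
    (hs : ∀ x ∈ D, s x ≤ 2) (h : HasBallPoincare v g D) (hv : IntegrableOn v D)
    (hg : AEMeasurable g (volume.restrict D)) :
    ∀ᵐ x ∂volume.restrict D, ‖v x - ⨍ y in ball x₀ (infDist x₀ (frontier D) / 4), v y‖ₑ
      ≤ ENNReal.ofReal (potentialConst n α β) *
        variableRieszPotential (fun x => s x * (n - 1 : ℕ)) g (volume.restrict D) x := by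
  have : NeZero n := ⟨by omega⟩
  have hA := hJ.kernelConst_nonneg
  filter_upwards [ae_tendsto_average_ball hJ.isOpen hv, ae_restrict_mem hJ.isOpen.measurableSet]
    with x hx hxD
  set ρ := infDist x (frontier D) / 4 with hρ
  have hρ0 : 0 < ρ := div_pos (hJ.infDist_frontier_pos hxD) four_pos
  have hball : closedBall x ρ ⊆ D := by
    simpa only [hρ, div_eq_inv_mul] using hJ.closedBall_subset hxD (c := 4⁻¹) (by norm_num)
  have htelescope := enorm_add_le (v x - ⨍ y in ball x ρ, v y)
    ((⨍ y in ball x ρ, v y) - ⨍ y in ball x₀ (infDist x₀ (frontier D) / 4), v y)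
  rw [sub_add_sub_cancel] at htelescope
  refine (htelescope.trans (add_le_add
    (h.enorm_sub_average_le hn hv hg hρ0 hball (hx ρ hρ0 hball))
    (hJ.enorm_average_sub_average_center_le h hv hg hxD (hs x hxD)))).trans ?_
  rw [← mul_add]
  refine (mul_le_mul_right (add_le_add_left
    (hJ.lintegral_mul_two_mul_inv_pow_le hxD (hs x hxD)) _) _).trans_eq ?_
  rw [lintegral_mul_ofReal_mul_rpow_dist (fun x => s x * (n - 1 : ℕ)) g (by positivity) x,
    lintegral_mul_ofReal_mul_rpow_dist (fun x => s x * (n - 1 : ℕ)) g (by positivity) x,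
    ← add_mul, ← ENNReal.ofReal_add (by positivity) (by positivity), ← mul_assoc,
    ← ENNReal.ofReal_mul averageConst_pos.le, potentialConst]

end IsJohnDomain

end Pointwise

/-! ### Weak-type estimates for potentials of variable order -/

section BallIntegral

open Metric Module

theorem pow_sub_one_smul_rpow_neg_eqOn {d : ℕ} (hd : 0 < d) (a : ℝ) :
    EqOn (fun r : ℝ => r ^ (d - 1) • r ^ (-a)) (fun r => r ^ ((d : ℝ) - 1 - a)) (Ioi 0) :=
  fun r hr => by
    have hexp : (d : ℝ) - 1 - a = ((d - 1 : ℕ) : ℝ) + -a := by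
      rw [Nat.cast_sub hd, Nat.cast_one]
      ring
    simp only [hexp, Real.rpow_add hr, Real.rpow_natCast, smul_eq_mul]

variable {V : Type*} [NormedAddCommGroup V] [NormedSpace ℝ V] [FiniteDimensional ℝ V]
  [Nontrivial V] [MeasurableSpace V] [BorelSpace V] (μ : Measure V) [μ.IsAddHaarMeasure]
  {a R : ℝ}

theorem integrableOn_ball_norm_rpow_neg (ha : a < finrank ℝ V) (hR : 0 < R) :
    IntegrableOn (fun x : V => ‖x‖ ^ (-a)) (ball 0 R) μ := by
  rw [integrableOn_fun_norm_addHaar μ (f := fun r => r ^ (-a)), integrableOn_congr_fun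
    ((pow_sub_one_smul_rpow_neg_eqOn finrank_pos a).mono Ioo_subset_Ioi_self) measurableSet_Ioo]
  exact (intervalIntegral.integrableOn_Ioo_rpow_iff hR).2 (by linarith)

theorem setIntegral_ball_norm_rpow_neg (ha : a < finrank ℝ V) (hR : 0 < R) :
    ∫ x : V in ball 0 R, ‖x‖ ^ (-a) ∂μ
      = finrank ℝ V * μ.real (ball 0 1) * (R ^ (finrank ℝ V - a) / (finrank ℝ V - a)) := by
  have hcutoff : (ball (0 : V) R).indicator (fun x => ‖x‖ ^ (-a))
      = fun x => (Iio R).indicator (fun r => r ^ (-a)) ‖x‖ := by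
    ext x
    simp [indicator]
  have hradial : EqOn
      (fun r : ℝ => r ^ (finrank ℝ V - 1) • (Iio R).indicator (fun r => r ^ (-a)) r)
      ((Iio R).indicator fun r => r ^ ((finrank ℝ V : ℝ) - 1 - a)) (Ioi 0) := fun r hr => by
    by_cases hrR : r ∈ Iio R
    · simpa only [indicator_of_mem hrR] using
        pow_sub_one_smul_rpow_neg_eqOn finrank_pos a hr
    · simp only [indicator_of_notMem hrR, smul_zero]
  rw [← integral_indicator measurableSet_ball, hcutoff, integral_fun_norm_addHaar,
    setIntegral_congr_fun measurableSet_Ioi hradial, setIntegral_indicator measurableSet_Iio,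
    Ioi_inter_Iio, ← integral_Ioc_eq_integral_Ioo, ← intervalIntegral.integral_of_le hR.le,
    integral_rpow (Or.inl (by linarith)), Real.zero_rpow (by linarith), sub_zero, nsmul_eq_mul,
    smul_eq_mul, ← mul_assoc, show (finrank ℝ V : ℝ) - 1 - a + 1 = finrank ℝ V - a by ring]

theorem setLIntegral_ball_dist_rpow_neg (ha : a < finrank ℝ V) (hR : 0 < R) (y : V) :
    ∫⁻ x in ball y R, ENNReal.ofReal (dist x y ^ (-a)) ∂μ
      = ENNReal.ofReal
        (finrank ℝ V * μ.real (ball 0 1) * (R ^ (finrank ℝ V - a) / (finrank ℝ V - a))) := by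
  have htranslate : ∀ x, (ball y R).indicator (fun x => ENNReal.ofReal (dist x y ^ (-a))) x
      = (ball 0 R).indicator (fun x => ENNReal.ofReal (‖x‖ ^ (-a))) (x - y) := fun x => by
    simp [indicator, dist_eq_norm]
  rw [← setIntegral_ball_norm_rpow_neg μ ha hR, ofReal_integral_eq_lintegral_ofReal
      (integrableOn_ball_norm_rpow_neg μ ha hR) (ae_of_all _ fun x => by positivity),
    ← lintegral_indicator measurableSet_ball, ← lintegral_indicator measurableSet_ball,
    lintegral_congr htranslate, lintegral_sub_right_eq_self]

end BallIntegral

section Freezing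

variable {X : Type*} [PseudoMetricSpace X]

/-- The geometric form of log-Hölder continuity: every power of the distance of two points whose
exponent is at most the oscillation of `a` between them is bounded by `Λ`. -/
def HasFreezingBound (Λ : ℝ) (a : X → ℝ) (D : Set X) : Prop :=
  ∀ x ∈ D, ∀ y ∈ D, 0 < dist x y → ∀ κ : ℝ, |κ| ≤ |a x - a y| → dist x y ^ κ ≤ Λ

namespace LogHolderOnWith

variable {n : ℕ} {D : Set (EuclideanSpace ℝ (Fin n))} {s : EuclideanSpace ℝ (Fin n) → ℝ} {L : ℝ}

theorem abs_sub_mul_log_inv_dist_le (hs : LogHolderOnWith L s D) {x y : EuclideanSpace ℝ (Fin n)}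
    (hx : x ∈ D) (hy : y ∈ D) (hxy : 0 < dist x y) :
    |s x - s y| * Real.log (dist x y)⁻¹ ≤ L := by
  have hinv : 0 < (dist x y)⁻¹ := inv_pos.2 hxy
  have hlog : Real.log (dist x y)⁻¹ ≤ Real.log (Real.exp 1 + 1 / dist x y) :=
    Real.log_le_log hinv (by linarith [Real.exp_pos 1, one_div (dist x y)])
  have hpos : 0 < Real.log (Real.exp 1 + 1 / dist x y) :=
    Real.log_pos (by linarith [Real.add_one_le_exp 1, one_div (dist x y)])
  have hmod := hs.2 x hx y hy (dist_pos.1 hxy)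
  rw [le_div_iff₀ hpos] at hmod
  exact (mul_le_mul_of_nonneg_left hlog (abs_nonneg _)).trans hmod

theorem rpow_dist_le (hs : LogHolderOnWith L s D) {M : ℝ} (hM : 1 ≤ M)
    {x y : EuclideanSpace ℝ (Fin n)} (hx : x ∈ D) (hy : y ∈ D) (hxy : 0 < dist x y)
    (hdist : dist x y ≤ M) (hosc : |s x - s y| ≤ 1) {κ : ℝ} (hκ : |κ| ≤ |s x - s y|) :
    dist x y ^ κ ≤ M * Real.exp L := by
  have hexp : 1 ≤ Real.exp L := Real.one_le_exp hs.1.le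
  rcases le_or_gt 1 (dist x y) with h | h
  · calc dist x y ^ κ ≤ dist x y ^ (1 : ℝ) :=
          Real.rpow_le_rpow_of_exponent_le h ((le_abs_self κ).trans (hκ.trans hosc))
      _ = dist x y := Real.rpow_one _
      _ ≤ M * Real.exp L := by nlinarith
  · have hlog : 0 ≤ Real.log (dist x y)⁻¹ := Real.log_nonneg ((one_le_inv₀ hxy).2 h.le)
    calc dist x y ^ κ = Real.exp (-κ * Real.log (dist x y)⁻¹) := by
          rw [Real.rpow_def_of_pos hxy, Real.log_inv, neg_mul_neg, mul_comm]
      _ ≤ Real.exp L := Real.exp_le_exp.2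
          ((mul_le_mul_of_nonneg_right ((neg_le_abs κ).trans hκ) hlog).trans
            (hs.abs_sub_mul_log_inv_dist_le hx hy hxy))
      _ ≤ M * Real.exp L := by nlinarith

theorem hasFreezingBound_mul (hs : LogHolderOnWith L s D) {M : ℝ} (hM : 1 ≤ M)
    (hdist : ∀ x ∈ D, ∀ y ∈ D, dist x y ≤ M) (hosc : ∀ x ∈ D, ∀ y ∈ D, |s x - s y| ≤ 1) (m : ℕ) :
    HasFreezingBound ((M * Real.exp L) ^ m) (fun x => s x * m) D := by
  intro x hx y hy hxy κ hκ
  rw [← sub_mul, abs_mul, Nat.abs_cast] at hκ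
  rcases Nat.eq_zero_or_pos m with rfl | hm
  · rw [Nat.cast_zero, mul_zero, abs_nonpos_iff] at hκ
    rw [hκ, Real.rpow_zero, pow_zero]
  have hmR : (0 : ℝ) < m := Nat.cast_pos.2 hm
  rw [← div_mul_cancel₀ κ hmR.ne', Real.rpow_mul dist_nonneg, Real.rpow_natCast]
  refine pow_le_pow_left₀ (Real.rpow_nonneg dist_nonneg _)
    (hs.rpow_dist_le hM hx hy hxy (hdist x hx y hy) (hosc x hx y hy) ?_) m
  rwa [abs_div, Nat.abs_cast, div_le_iff₀ hmR]

theorem continuousOn (hs : LogHolderOnWith L s D) : ContinuousOn s D := by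
  rw [Metric.continuousOn_iff]
  intro x hx ε hε
  refine ⟨Real.exp (-(L / ε)), Real.exp_pos _, fun y hy hyx => ?_⟩
  rcases (dist_nonneg (x := y) (y := x)).eq_or_lt with h | h
  · rwa [← dist_eq_zero.1 h.symm, dist_self]
  have hlog : L / ε < Real.log (dist y x)⁻¹ := by
    rwa [Real.log_inv, lt_neg, Real.log_lt_iff_lt_exp h]
  have hlog0 : 0 < Real.log (dist y x)⁻¹ := (div_pos hs.1 hε).trans hlog
  rw [Real.dist_eq]
  by_contra! hε'
  have hosc := hs.abs_sub_mul_log_inv_dist_le hy hx h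
  rw [div_lt_iff₀ hε, mul_comm] at hlog
  exact hlog.not_ge ((mul_le_mul_of_nonneg_right hε' hlog0.le).trans hosc)

end LogHolderOnWith

section Exponents

variable {r t a a' Λ : ℝ}

theorem rpow_neg_le_mul_rpow_neg (hr : 0 < r) (hΛ : r ^ (a' - a) ≤ Λ) :
    r ^ (-a) ≤ Λ * r ^ (-a') := by
  rw [show -a = a' - a + -a' by ring, Real.rpow_add hr]
  gcongr

theorem lt_rpow_inv_of_lt_rpow_neg (hr : 0 < r) (ht : 0 < t) (ha' : 0 < a') (hΛ0 : 0 < Λ)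
    (hΛ : r ^ (a' - a) ≤ Λ) (hlarge : t / 2 < r ^ (-a)) : r < (2 * Λ / t) ^ a'⁻¹ := by
  rw [Real.lt_rpow_inv_iff_of_pos hr.le (by positivity) ha']
  have hra : r ^ a < 2 / t := by
    rwa [Real.rpow_neg hr.le, lt_inv_comm₀ (by positivity) (by positivity), inv_div] at hlarge
  calc r ^ a' = r ^ (a' - a) * r ^ a := by rw [← Real.rpow_add hr, sub_add_cancel]
    _ ≤ Λ * r ^ a := by gcongr
    _ < Λ * (2 / t) := by gcongr
    _ = 2 * Λ / t := by ring

theorem rpow_div_le_mul_rpow_div {p : ℝ} (hp : 0 ≤ p) (hr : 0 < r) (ht : 1 ≤ t) (ha : 1 ≤ a)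
    (ha' : 1 ≤ a') (hΛ1 : 1 ≤ Λ) (hΛ : ∀ κ : ℝ, |κ| ≤ |a - a'| → r ^ κ ≤ Λ)
    (hlarge : t / 2 < r ^ (-a)) : t ^ (p / a) ≤ (2 * Λ) ^ p * t ^ (p / a') := by
  rcases le_total (p / a) (p / a') with h | h
  · calc t ^ (p / a) ≤ t ^ (p / a') := Real.rpow_le_rpow_of_exponent_le ht h
      _ ≤ (2 * Λ) ^ p * t ^ (p / a') :=
        le_mul_of_one_le_left (by positivity) (Real.one_le_rpow (by linarith) hp)
  · have hexp : -a * (p / a - p / a') = (a - a') / a' * p := by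
      field_simp
      ring
    have hle : p / a - p / a' ≤ p := by
      linarith [div_le_self hp ha, div_nonneg hp (zero_le_one.trans ha')]
    have hκ : |(a - a') / a'| ≤ |a - a'| := by
      rw [abs_div, abs_of_pos (by linarith : 0 < a')]
      exact div_le_self (abs_nonneg _) ha'
    rw [← sub_add_cancel (p / a) (p / a'), Real.rpow_add (by linarith)]
    gcongr
    calc t ^ (p / a - p / a') ≤ (2 * r ^ (-a)) ^ (p / a - p / a') :=
          Real.rpow_le_rpow (by linarith) (by linarith) (by linarith)
      _ = 2 ^ (p / a - p / a') * (r ^ ((a - a') / a')) ^ p := by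
          rw [Real.mul_rpow two_pos.le (by positivity), ← Real.rpow_mul hr.le, hexp,
            Real.rpow_mul hr.le]
      _ ≤ 2 ^ p * Λ ^ p := by
          gcongr
          · exact one_le_two
          · exact hΛ _ hκ
      _ = (2 * Λ) ^ p := (Real.mul_rpow two_pos.le (by linarith)).symm

end Exponents

end Freezing

section WeakType

open Metric Module

theorem mul_lintegral_le_of_schur {X Y : Type*} [MeasurableSpace X] [MeasurableSpace Y]
    {ν : Measure X} {μ : Measure Y} [SFinite ν] [SFinite μ] {g : Y → ℝ≥0∞} {K : X → Y → ℝ≥0∞}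
    {W : X → ℝ≥0∞} (hg : Measurable g) (hK : Measurable (Function.uncurry K)) (hW : Measurable W)
    {a b : ℝ≥0∞} (ha : ∀ᵐ x ∂ν, a ≤ ∫⁻ y, g y * K x y ∂μ)
    (hb : ∀ᵐ y ∂μ, ∫⁻ x, K x y * W x ∂ν ≤ b) :
    a * ∫⁻ x, W x ∂ν ≤ (∫⁻ y, g y ∂μ) * b := by
  have hK₁ : ∀ x, Measurable (K x) := fun x => hK.comp measurable_prodMk_left
  have hK₂ : ∀ y, Measurable fun x => K x y := fun y => hK.comp measurable_prodMk_right
  calc a * ∫⁻ x, W x ∂ν = ∫⁻ x, a * W x ∂ν := (lintegral_const_mul _ hW).symm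
    _ ≤ ∫⁻ x, (∫⁻ y, g y * K x y ∂μ) * W x ∂ν := by
        refine lintegral_mono_ae ?_
        filter_upwards [ha] with x hx
        gcongr
    _ = ∫⁻ x, ∫⁻ y, g y * K x y * W x ∂μ ∂ν :=
        lintegral_congr fun x => (lintegral_mul_const _ (hg.mul (hK₁ x))).symm
    _ = ∫⁻ y, ∫⁻ x, g y * K x y * W x ∂ν ∂μ := by
        refine lintegral_lintegral_swap (Measurable.aemeasurable ?_)
        exact ((hg.comp measurable_snd).mul hK).mul (hW.comp measurable_fst)
    _ = ∫⁻ y, g y * ∫⁻ x, K x y * W x ∂ν ∂μ := by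
        refine lintegral_congr fun y => ?_
        simp_rw [mul_assoc]
        exact lintegral_const_mul _ ((hK₂ y).mul hW)
    _ ≤ ∫⁻ y, g y * b ∂μ := by
        refine lintegral_mono_ae ?_
        filter_upwards [hb] with y hy
        gcongr
    _ = (∫⁻ y, g y ∂μ) * b := lintegral_mul_const _ hg

theorem le_two_mul_of_mul_le_half_mul_add {N t m C : ℝ≥0∞} (hN : N ≤ 1) (hm : m ≠ ⊤)
    (ht0 : t ≠ 0) (ht : t ≠ ⊤) (h : t * m ≤ N * (t / 2 * m + C * t)) : m ≤ 2 * C * N := by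
  have hhalf : t / 2 * m + t / 2 * m ≤ t / 2 * m + t / 2 * (2 * C * N) := by
    calc t / 2 * m + t / 2 * m = t * m := by rw [← add_mul, ENNReal.add_halves]
      _ ≤ N * (t / 2 * m + C * t) := h
      _ = N * (t / 2 * m) + t / 2 * 2 * (C * N) := by
          rw [ENNReal.div_mul_cancel two_ne_zero ENNReal.ofNat_ne_top]
          ring
      _ ≤ 1 * (t / 2 * m) + t / 2 * 2 * (C * N) := by gcongr
      _ = t / 2 * m + t / 2 * (2 * C * N) := by ring
  have ht2 : t / 2 ≠ ⊤ := ENNReal.div_ne_top ht two_ne_zero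
  exact (ENNReal.mul_le_mul_iff_right (ENNReal.half_pos ht0).ne' ht2).1
    ((ENNReal.add_le_add_iff_left (ENNReal.mul_ne_top ht2 hm)).1 hhalf)

theorem setLIntegral_rpow_div_ne_top {X : Type*} [MeasurableSpace X] {μ : Measure X} {D F : Set X}
    {a : X → ℝ} {d t : ℝ} (hD : μ D ≠ ⊤) (hd : 0 ≤ d) (ha1 : ∀ x ∈ D, 1 ≤ a x) (ht : 1 ≤ t)
    (hF : MeasurableSet F) (hFD : F ⊆ D) :
    ∫⁻ x in F, ENNReal.ofReal (t ^ (d / a x)) ∂μ ≠ ⊤ := by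
  refine ((setLIntegral_mono' hF (g := fun _ => ENNReal.ofReal (t ^ d))
    fun x hx => ?_).trans_lt ?_).ne
  · gcongr
    exact div_le_self hd (ha1 x (hFD hx))
  · rw [setLIntegral_const]
    exact ENNReal.mul_lt_top ENNReal.ofReal_lt_top ((measure_mono hFD).trans_lt hD.lt_top)

theorem measurable_variableRieszPotential {X : Type*} [PseudoMetricSpace X]
    [SecondCountableTopology X] [MeasurableSpace X] [OpensMeasurableSpace X] (μ : Measure X)
    [SFinite μ] {a : X → ℝ} {g : X → ℝ≥0∞} (ha : Measurable a) (hg : Measurable g) :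
    Measurable (variableRieszPotential a g μ) := by
  refine Measurable.lintegral_prod_right' (f := fun p : X × X =>
    g p.2 * ENNReal.ofReal (dist p.1 p.2 ^ (-a p.1))) ?_
  fun_prop

variable {V : Type*} [NormedAddCommGroup V] [NormedSpace ℝ V] [FiniteDimensional ℝ V]
  [Nontrivial V] [MeasurableSpace V] [BorelSpace V] (μ : Measure V) [μ.IsAddHaarMeasure]
  {D : Set V} {a : V → ℝ} {A Λ t : ℝ}

/-- The constant in the bound of the integral of the part of the kernel `|x - y| ^ (-a(x))` that
exceeds half of the level, for exponents with freezing bound `Λ` and values in `[1, A]`. -/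
noncomputable def largeKernelConst (A Λ : ℝ) : ℝ :=
  Λ * (2 * Λ) ^ (finrank ℝ V : ℝ) *
    (finrank ℝ V * μ.real (ball 0 1) * ((2 * Λ) ^ (finrank ℝ V : ℝ) / (finrank ℝ V - A)))

theorem mul_setLIntegral_ball_le_largeKernelConst {b : ℝ} (hb : 1 ≤ b) (hbA : b ≤ A)
    (hA : A < finrank ℝ V) (hΛ : 1 ≤ Λ) (ht : 1 ≤ t) (y : V) :
    ENNReal.ofReal (Λ * (2 * Λ) ^ (finrank ℝ V : ℝ) * t ^ (finrank ℝ V / b)) *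
        ∫⁻ x in ball y ((2 * Λ / t) ^ b⁻¹), ENNReal.ofReal (dist x y ^ (-b)) ∂μ
      ≤ ENNReal.ofReal (largeKernelConst μ A Λ) * ENNReal.ofReal t := by
  have : 0 < finrank ℝ V - A := sub_pos.2 hA
  have hradius : ((2 * Λ / t) ^ b⁻¹) ^ (finrank ℝ V - b)
      ≤ (2 * Λ) ^ (finrank ℝ V : ℝ) * t ^ (1 - finrank ℝ V / b) := by
    have hexp : b⁻¹ * (finrank ℝ V - b) = finrank ℝ V / b - 1 := by
      field_simp
    have hle : (finrank ℝ V : ℝ) / b ≤ finrank ℝ V := div_le_self (Nat.cast_nonneg _) hb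
    rw [← Real.rpow_mul (by positivity), hexp, Real.div_rpow (by positivity) (by positivity),
      div_eq_mul_inv, ← Real.rpow_neg (by positivity), neg_sub]
    gcongr <;> linarith
  have ht' : t ^ ((finrank ℝ V : ℝ) / b) * t ^ (1 - (finrank ℝ V : ℝ) / b) = t := by
    rw [← Real.rpow_add (by linarith), add_sub_cancel, Real.rpow_one]
  rw [setLIntegral_ball_dist_rpow_neg μ (by linarith) (by positivity), largeKernelConst,
    ← ENNReal.ofReal_mul (by positivity), ← ENNReal.ofReal_mul (by positivity)]
  refine ENNReal.ofReal_le_ofReal ?_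
  calc Λ * (2 * Λ) ^ (finrank ℝ V : ℝ) * t ^ ((finrank ℝ V : ℝ) / b) *
        (finrank ℝ V * μ.real (ball 0 1) *
          (((2 * Λ / t) ^ b⁻¹) ^ (finrank ℝ V - b) / (finrank ℝ V - b)))
      ≤ Λ * (2 * Λ) ^ (finrank ℝ V : ℝ) * t ^ ((finrank ℝ V : ℝ) / b) *
        (finrank ℝ V * μ.real (ball 0 1) *
          ((2 * Λ) ^ (finrank ℝ V : ℝ) * t ^ (1 - (finrank ℝ V : ℝ) / b)
            / (finrank ℝ V - A))) := by gcongr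
    _ = _ := by linear_combination (Λ * (2 * Λ) ^ (finrank ℝ V : ℝ) * (finrank ℝ V *
          μ.real (ball 0 1) * ((2 * Λ) ^ (finrank ℝ V : ℝ) / (finrank ℝ V - A)))) * ht'

theorem setLIntegral_indicator_large_kernel_le (hD : MeasurableSet D) (hΛ : 1 ≤ Λ)
    (hfreeze : HasFreezingBound Λ a D) (ha1 : ∀ x ∈ D, 1 ≤ a x) (haA : ∀ x ∈ D, a x ≤ A)
    (hA : A < finrank ℝ V) (ht : 1 ≤ t) {y : V} (hy : y ∈ D) :
    ∫⁻ x in D, {x | t / 2 < dist x y ^ (-a x)}.indicator (fun x =>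
        ENNReal.ofReal (dist x y ^ (-a x)) * ENNReal.ofReal (t ^ (finrank ℝ V / a x))) x ∂μ
      ≤ ENNReal.ofReal (largeKernelConst μ A Λ) * ENNReal.ofReal t := by
  refine le_trans ?_ (mul_setLIntegral_ball_le_largeKernelConst μ (ha1 y hy) (haA y hy) hA hΛ ht y)
  rw [← lintegral_const_mul' _ _ ENNReal.ofReal_ne_top, ← lintegral_indicator measurableSet_ball]
  refine (setLIntegral_mono' hD fun x hx => ?_).trans (setLIntegral_le_lintegral _ _)
  refine indicator_apply_le' (fun hlarge => ?_) fun _ => zero_le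
  have hxy : 0 < dist x y := by
    refine dist_nonneg.lt_of_ne fun h => ?_
    rw [mem_ofPred_eq, ← h, Real.zero_rpow (by linarith [ha1 x hx])] at hlarge
    linarith
  have hΛ' := hfreeze x hx y hy hxy
  have hΛyx : dist x y ^ (a y - a x) ≤ Λ := hΛ' _ (abs_sub_comm _ _).le
  have hball : x ∈ ball y ((2 * Λ / t) ^ (a y)⁻¹) :=
    lt_rpow_inv_of_lt_rpow_neg hxy (by linarith) (by linarith [ha1 y hy]) (by linarith) hΛyx hlarge
  rw [indicator_of_mem hball, ← ENNReal.ofReal_mul (by positivity),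
    ← ENNReal.ofReal_mul (by positivity)]
  refine ENNReal.ofReal_le_ofReal ?_
  calc dist x y ^ (-a x) * t ^ (finrank ℝ V / a x)
      ≤ (Λ * dist x y ^ (-a y)) *
          ((2 * Λ) ^ (finrank ℝ V : ℝ) * t ^ (finrank ℝ V / a y)) := by
        gcongr
        · exact rpow_neg_le_mul_rpow_neg hxy hΛyx
        · exact rpow_div_le_mul_rpow_div (Nat.cast_nonneg _) hxy ht (ha1 x hx) (ha1 y hy) hΛ hΛ'
            hlarge
    _ = _ := by ring

theorem setLIntegral_kernel_mul_weight_le (hD : MeasurableSet D) (ha : Measurable a) (hΛ : 1 ≤ Λ)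
    (hfreeze : HasFreezingBound Λ a D) (ha1 : ∀ x ∈ D, 1 ≤ a x) (haA : ∀ x ∈ D, a x ≤ A)
    (hA : A < finrank ℝ V) (ht : 1 ≤ t) {F : Set V} (hF : MeasurableSet F) (hFD : F ⊆ D) {y : V}
    (hy : y ∈ D) :
    ∫⁻ x in F, ENNReal.ofReal (dist x y ^ (-a x)) * ENNReal.ofReal (t ^ (finrank ℝ V / a x)) ∂μ
      ≤ ENNReal.ofReal t / 2 * ∫⁻ x in F, ENNReal.ofReal (t ^ (finrank ℝ V / a x)) ∂μ
        + ENNReal.ofReal (largeKernelConst μ A Λ) * ENNReal.ofReal t := by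
  have hW : Measurable fun x => ENNReal.ofReal (t ^ (finrank ℝ V / a x)) := by fun_prop
  set Q : Set V := {x | t / 2 < dist x y ^ (-a x)}
  refine le_trans ?_ (add_le_add_right ((lintegral_mono_set hFD).trans
    (setLIntegral_indicator_large_kernel_le μ hD hΛ hfreeze ha1 haA hA ht hy)) _)
  rw [← lintegral_const_mul _ hW, ← lintegral_add_left (hW.const_mul _)]
  refine setLIntegral_mono' hF fun x _ => ?_
  by_cases hxQ : x ∈ Q
  · rw [indicator_of_mem hxQ]
    exact le_add_self
  · rw [indicator_of_notMem hxQ, add_zero, ← ENNReal.ofReal_ofNat 2,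
      ← ENNReal.ofReal_div_of_pos two_pos]
    gcongr
    exact not_lt.1 hxQ

theorem setLIntegral_superlevel_variableRieszPotential_le_of_measurable {g : V → ℝ≥0∞}
    (hD : MeasurableSet D) (hDfin : μ D ≠ ⊤) (ha : Measurable a) (hg : Measurable g) (hΛ : 1 ≤ Λ)
    (hfreeze : HasFreezingBound Λ a D) (ha1 : ∀ x ∈ D, 1 ≤ a x) (haA : ∀ x ∈ D, a x ≤ A)
    (hA : A < finrank ℝ V) (hg1 : ∫⁻ y in D, g y ∂μ ≤ 1) (ht : 1 ≤ t) :
    ∫⁻ x in {x ∈ D | ENNReal.ofReal t < variableRieszPotential a g (μ.restrict D) x},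
        ENNReal.ofReal (t ^ (finrank ℝ V / a x)) ∂μ
      ≤ 2 * ENNReal.ofReal (largeKernelConst μ A Λ) * ∫⁻ y in D, g y ∂μ := by
  have hK : Measurable (Function.uncurry fun x y => ENNReal.ofReal (dist x y ^ (-a x))) := by
    simp only [Function.uncurry_def]
    fun_prop
  have hF := hD.inter (measurableSet_lt (measurable_const (a := ENNReal.ofReal t))
    (measurable_variableRieszPotential (μ.restrict D) ha hg))
  have hFD := sep_subset D fun x => ENNReal.ofReal t < variableRieszPotential a g (μ.restrict D) x
  refine le_two_mul_of_mul_le_half_mul_add hg1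
    (setLIntegral_rpow_div_ne_top hDfin (Nat.cast_nonneg _) ha1 ht hF hFD)
    (ENNReal.ofReal_pos.2 (by linarith)).ne' ENNReal.ofReal_ne_top
    (mul_lintegral_le_of_schur hg hK (by fun_prop) ?_ ?_)
  · filter_upwards [ae_restrict_mem hF] with x hx using hx.2.le
  · filter_upwards [ae_restrict_mem hD] with y hy using
      setLIntegral_kernel_mul_weight_le μ hD ha hΛ hfreeze ha1 haA hA ht hF hFD hy

theorem setLIntegral_superlevel_variableRieszPotential_le {g : V → ℝ≥0∞} (hD : MeasurableSet D)
    (hDfin : μ D ≠ ⊤) (ha : ContinuousOn a D) (hg : AEMeasurable g (μ.restrict D)) (hΛ : 1 ≤ Λ)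
    (hfreeze : HasFreezingBound Λ a D) (ha1 : ∀ x ∈ D, 1 ≤ a x) (haA : ∀ x ∈ D, a x ≤ A)
    (hA : A < finrank ℝ V) (hg1 : ∫⁻ y in D, g y ∂μ ≤ 1) (ht : 1 ≤ t) :
    ∫⁻ x in {x ∈ D | ENNReal.ofReal t < variableRieszPotential a g (μ.restrict D) x},
        ENNReal.ofReal (t ^ (finrank ℝ V / a x)) ∂μ
      ≤ 2 * ENNReal.ofReal (largeKernelConst μ A Λ) * ∫⁻ y in D, g y ∂μ := by
  classical
  have haD : ∀ x ∈ D, D.indicator a x = a x := fun x hx => indicator_of_mem hx a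
  have hmeas : Measurable (D.indicator a) := by
    rw [← piecewise_eq_indicator]
    exact ha.measurable_piecewise continuousOn_const hD
  have hfreeze' : HasFreezingBound Λ (D.indicator a) D := fun x hx y hy hxy => by
    rw [haD x hx, haD y hy]
    exact hfreeze x hx y hy hxy
  have hgg := hg.ae_eq_mk
  have hset : {x ∈ D | ENNReal.ofReal t < variableRieszPotential a g (μ.restrict D) x}
      = {x ∈ D | ENNReal.ofReal t
          < variableRieszPotential (D.indicator a) (hg.mk g) (μ.restrict D) x} := by
    refine Set.ext fun x => and_congr_right fun hx => ?_
    rw [variableRieszPotential, variableRieszPotential, haD x hx,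
      lintegral_congr_ae (hgg.mono fun y hy => congrArg (· * _) hy)]
  rw [lintegral_congr_ae hgg] at hg1 ⊢
  refine le_trans (le_of_eq ?_) (setLIntegral_superlevel_variableRieszPotential_le_of_measurable μ
    hD hDfin hmeas hg.measurable_mk hΛ hfreeze' (fun x hx => (haD x hx).symm ▸ ha1 x hx)
    (fun x hx => (haD x hx).symm ▸ haA x hx) hA hg1 ht)
  rw [hset]
  exact setLIntegral_congr_fun (hD.inter (measurableSet_lt measurable_const
    (measurable_variableRieszPotential _ hmeas hg.measurable_mk))) fun x hx => by rw [haD x hx.1]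

end WeakType

/-! ### Truncation -/

section Truncation

/-- A smooth even function that vanishes on `[-1, 1]` and is `1` outside `(-2, 2)`. -/
noncomputable def smoothTruncation (t : ℝ) : ℝ :=
  Real.smoothTransition (t - 1) + Real.smoothTransition (-t - 1)

theorem contDiff_smoothTruncation : ContDiff ℝ 1 smoothTruncation := by
  unfold smoothTruncation
  exact (Real.smoothTransition.contDiff.comp (by fun_prop)).add
    (Real.smoothTransition.contDiff.comp (by fun_prop))

theorem smoothTruncation_nonneg (t : ℝ) : 0 ≤ smoothTruncation t :=
  add_nonneg (Real.smoothTransition.nonneg _) (Real.smoothTransition.nonneg _)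

theorem smoothTruncation_le_one (t : ℝ) : smoothTruncation t ≤ 1 := by
  unfold smoothTruncation
  rcases le_total t 0 with h | h
  · rw [Real.smoothTransition.zero_of_nonpos (by linarith), zero_add]
    exact Real.smoothTransition.le_one _
  · rw [Real.smoothTransition.zero_of_nonpos (x := -t - 1) (by linarith), add_zero]
    exact Real.smoothTransition.le_one _

theorem smoothTruncation_eq_zero {t : ℝ} (ht : |t| ≤ 1) : smoothTruncation t = 0 := by
  unfold smoothTruncation
  rw [abs_le] at ht
  rw [Real.smoothTransition.zero_of_nonpos (by linarith),
    Real.smoothTransition.zero_of_nonpos (by linarith), zero_add]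

theorem smoothTruncation_eq_one {t : ℝ} (ht : 2 ≤ |t|) : smoothTruncation t = 1 := by
  unfold smoothTruncation
  rcases le_abs.1 ht with h | h
  · rw [Real.smoothTransition.one_of_one_le (by linarith),
      Real.smoothTransition.zero_of_nonpos (by linarith), add_zero]
  · rw [Real.smoothTransition.zero_of_nonpos (by linarith),
      Real.smoothTransition.one_of_one_le (by linarith), zero_add]

theorem deriv_smoothTruncation_eq_zero {t : ℝ} (ht : ¬(1 < |t| ∧ |t| < 2)) :
    deriv smoothTruncation t = 0 := by
  rcases le_or_gt |t| 1 with h | h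
  · refine IsLocalMin.deriv_eq_zero (Filter.Eventually.of_forall fun x => ?_)
    rw [smoothTruncation_eq_zero h]
    exact smoothTruncation_nonneg x
  · refine IsLocalMax.deriv_eq_zero (Filter.Eventually.of_forall fun x => ?_)
    rw [smoothTruncation_eq_one (not_lt.1 fun h2 => ht ⟨h, h2⟩)]
    exact smoothTruncation_le_one x

theorem exists_enorm_deriv_smoothTruncation_le :
    ∃ M : ℝ≥0, ∀ t, ‖deriv smoothTruncation t‖ₑ ≤ M := by
  have hc : Continuous (deriv smoothTruncation) :=
    contDiff_smoothTruncation.continuous_deriv le_rfl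
  have hsupp : HasCompactSupport (deriv smoothTruncation) :=
    HasCompactSupport.intro (isCompact_Icc (a := -2) (b := 2)) fun t ht =>
      deriv_smoothTruncation_eq_zero fun h => ht (abs_le.1 h.2.le)
  obtain ⟨M, hM⟩ := hc.bounded_above_of_compact_support hsupp
  refine ⟨M.toNNReal, fun t => ?_⟩
  rw [← ofReal_norm]
  exact ENNReal.ofReal_le_ofReal (hM t)

theorem mul_smoothTruncation_div_le_abs {l : ℝ} (hl : 0 < l) (t : ℝ) :
    l * smoothTruncation (t / l) ≤ |t| := by
  rcases le_total |t| l with h | h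
  · rw [smoothTruncation_eq_zero (by rwa [abs_div, abs_of_pos hl, div_le_one hl]), mul_zero]
    exact abs_nonneg t
  · exact (mul_le_of_le_one_right hl.le (smoothTruncation_le_one _)).trans h

theorem deriv_const_mul_comp_div {f : ℝ → ℝ} {l : ℝ} (hl : l ≠ 0) (t : ℝ) :
    deriv (fun t => l * f (t / l)) t = deriv f (t / l) := by
  simp only [div_eq_inv_mul]
  rw [deriv_const_mul_field, deriv_comp_mul_left, smul_eq_mul, mul_inv_cancel_left₀ hl]

end Truncation

section TruncationProperty

variable {n : ℕ} {v : EuclideanSpace ℝ (Fin n) → ℝ} {g : EuclideanSpace ℝ (Fin n) → ℝ≥0∞}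
  {D : Set (EuclideanSpace ℝ (Fin n))}

/-- The truncation property of the pair `(v, g)`: the Poincaré inequality on balls survives the
composition of `v` with a `C¹` function `Φ` of bounded derivative, when `g` is replaced by
`|Φ' ∘ v| g`. For smooth truncations `Φ` it localizes `g` to a level set of `v`. -/
def HasTruncationProperty (v : EuclideanSpace ℝ (Fin n) → ℝ)
    (g : EuclideanSpace ℝ (Fin n) → ℝ≥0∞) (D : Set (EuclideanSpace ℝ (Fin n))) : Prop :=
  ∀ ⦃Φ : ℝ → ℝ⦄, ContDiff ℝ 1 Φ → (∃ M : ℝ≥0, ∀ t, ‖deriv Φ t‖ₑ ≤ M) →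
    HasBallPoincare (fun x => Φ (v x)) (fun x => ‖deriv Φ (v x)‖ₑ * g x) D

theorem HasWeakGradientOn.hasTruncationProperty
    {G : EuclideanSpace ℝ (Fin n) → EuclideanSpace ℝ (Fin n)} (h : HasWeakGradientOn v G D)
    (hD : IsOpen D) : HasTruncationProperty v (fun x => ‖G x‖ₑ) D := by
  rintro Φ hΦ ⟨M, hM⟩ z r hr
  exact h.lintegral_lintegral_enorm_comp_sub_le hD hr hΦ hM

theorem HasBallPoincare.mono {g' : EuclideanSpace ℝ (Fin n) → ℝ≥0∞} (h : HasBallPoincare v g D)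
    (hg : ∀ x, g x ≤ g' x) : HasBallPoincare v g' D := by
  intro z r hr
  refine (h z r hr).trans ?_
  gcongr
  exact hg _

namespace HasTruncationProperty

theorem hasBallPoincare (h : HasTruncationProperty v g D) : HasBallPoincare v g D := by
  simpa using h contDiff_id ⟨1, by simp⟩

theorem sub_const_div_const (h : HasTruncationProperty v g D) (c : ℝ) {N : ℝ} (hN : 0 < N) :
    HasTruncationProperty (fun x => (v x - c) / N) (fun x => g x / ENNReal.ofReal N) D := by
  rintro Φ hΦ ⟨M, hM⟩
  have hderiv : ∀ t, deriv (fun t => Φ ((t - c) / N)) t = deriv Φ ((t - c) / N) / N := fun t =>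
    (((hΦ.differentiable one_ne_zero _).hasDerivAt.comp t
      (((hasDerivAt_id t).sub_const c).div_const N)).congr_deriv (mul_one_div _ _)).deriv
  have henorm : ∀ t, ‖deriv (fun t => Φ ((t - c) / N)) t‖ₑ
      = ‖deriv Φ ((t - c) / N)‖ₑ / ENNReal.ofReal N := fun t => by
    rw [hderiv, ← ofReal_norm, norm_div, Real.norm_of_nonneg hN.le,
      ENNReal.ofReal_div_of_pos hN, ofReal_norm]
  refine (h (Φ := fun t => Φ ((t - c) / N)) (hΦ.comp (by fun_prop))
    ⟨M / N.toNNReal, fun t => ?_⟩).mono fun x => ?_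
  · rw [henorm, ENNReal.coe_div (Real.toNNReal_pos.2 hN).ne']
    exact ENNReal.div_le_div_right (hM _) _
  · rw [henorm]
    exact (by simp only [div_eq_mul_inv]; ring : _ = _).le

theorem hasBallPoincare_smoothTruncation (h : HasTruncationProperty v g D) {M : ℝ≥0}
    (hM : ∀ t, ‖deriv smoothTruncation t‖ₑ ≤ M) {l : ℝ} (hl : 0 < l) :
    HasBallPoincare (fun x => l * smoothTruncation (v x / l))
      (fun x => M * {x | l < |v x| ∧ |v x| < 2 * l}.indicator g x) D := by
  have hderiv := deriv_const_mul_comp_div (f := smoothTruncation) hl.ne'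
  refine (h (Φ := fun t => l * smoothTruncation (t / l))
    (contDiff_const.mul (contDiff_smoothTruncation.comp (by fun_prop)))
    ⟨M, fun t => (hderiv t).symm ▸ hM _⟩).mono fun x => ?_
  rw [hderiv]
  by_cases hx : l < |v x| ∧ |v x| < 2 * l
  · rw [indicator_of_mem (by exact hx)]
    gcongr
    exact hM _
  · rw [deriv_smoothTruncation_eq_zero, enorm_zero, zero_mul]
    · exact zero_le
    · rwa [abs_div, abs_of_pos hl, one_lt_div hl, div_lt_iff₀ hl]

end HasTruncationProperty

end TruncationProperty

section CentralBall

open Filter Topology Metric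

variable {n : ℕ} {v : EuclideanSpace ℝ (Fin n) → ℝ} {g : EuclideanSpace ℝ (Fin n) → ℝ≥0∞}
  {D : Set (EuclideanSpace ℝ (Fin n))} {z : EuclideanSpace ℝ (Fin n)} {δ : ℝ}

theorem iUnion_ball_of_tendsto {X : Type*} [PseudoMetricSpace X] (x : X) {r : ℕ → ℝ}
    (hr : ∀ k, r k ≤ δ) (hlim : Tendsto r atTop (𝓝 δ)) : ⋃ k, ball x (r k) = ball x δ := by
  refine Subset.antisymm (iUnion_subset fun k => ball_subset_ball (hr k)) fun y hy => ?_
  exact mem_iUnion.2 (hlim.eventually_const_lt (mem_ball.1 hy)).exists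

namespace HasBallPoincare

theorem lintegral_lintegral_le_of_ball_subset (h : HasBallPoincare v g D)
    (hv : AEMeasurable v (volume.restrict D)) (hz : ball z δ ⊆ D) :
    ∫⁻ x in ball z δ, ∫⁻ y in ball z δ, ‖v x - v y‖ₑ
      ≤ 2 ^ (n + 1) * ENNReal.ofReal δ * volume (ball z δ) * ∫⁻ y in ball z δ, g y := by
  obtain ⟨r, hmono, hlt, hlim⟩ := exists_seq_strictMono_tendsto δ
  have hsub : ∀ k, ball z (r k) ⊆ ball z δ := fun k => ball_subset_ball (hlt k).le
  have hprod : ∀ {ρ}, ball z ρ ⊆ D →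
      ∫⁻ x in ball z ρ, ∫⁻ y in ball z ρ, ‖v x - v y‖ₑ
        = ∫⁻ p in ball (z, z) ρ, ‖v p.1 - v p.2‖ₑ ∂volume.prod volume := fun {ρ} hρ => by
    have hv' := hv.mono_measure (Measure.restrict_mono hρ le_rfl)
    rw [← ball_prod_same, setLIntegral_prod]
    rw [← Measure.prod_restrict]
    exact (hv'.comp_fst.sub hv'.comp_snd).enorm
  rw [hprod hz, ← iUnion_ball_of_tendsto (z, z) (fun k => (hlt k).le) hlim,
    setLIntegral_iUnion_of_directed _
      (Monotone.directed_le fun i j hij => ball_subset_ball (hmono.monotone hij))]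
  refine iSup_le fun k => ?_
  rw [← hprod ((hsub k).trans hz)]
  refine (h z (r k) ((closedBall_subset_ball (hlt k)).trans hz)).trans ?_
  gcongr
  exacts [(hlt k).le, (hlt k).le, (hlt k).le]

theorem integrableOn_ball (h : HasBallPoincare v g D) (hv : AEMeasurable v (volume.restrict D))
    (hg : ∫⁻ x in D, g x ≠ ⊤) (hz : ball z δ ⊆ D) : IntegrableOn v (ball z δ) := by
  rcases le_or_gt δ 0 with hδ | hδ
  · simp [ball_eq_empty.2 hδ]
  have hfin : ∫⁻ x in ball z δ, ∫⁻ y in ball z δ, ‖v x - v y‖ₑ ≠ ⊤ := by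
    refine ((h.lintegral_lintegral_le_of_ball_subset hv hz).trans_lt ?_).ne
    have hgz : ∫⁻ y in ball z δ, g y ≠ ⊤ := ((lintegral_mono_set hz).trans_lt hg.lt_top).ne
    finiteness
  obtain ⟨x, hx⟩ : ∃ x, ∫⁻ y in ball z δ, ‖v x - v y‖ₑ ≠ ⊤ := by
    by_contra! htop
    refine hfin ?_
    simp only [htop, setLIntegral_const]
    exact ENNReal.top_mul (measure_ball_pos _ _ hδ).ne'
  have hvz := hv.mono_measure (Measure.restrict_mono hz le_rfl)
  have hsub : IntegrableOn (fun y => v x - v y) (ball z δ) :=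
    ⟨(aemeasurable_const.sub hvz).aestronglyMeasurable, hx.lt_top⟩
  refine (IntegrableOn.sub (integrableOn_const (C := v x) measure_ball_lt_top.ne) hsub).congr_fun
    (fun y _ => sub_sub_cancel (v x) (v y)) measurableSet_ball

theorem lintegral_enorm_sub_average_le (h : HasBallPoincare v g D)
    (hv : AEMeasurable v (volume.restrict D)) (hg : ∫⁻ x in D, g x ≠ ⊤) (hδ : 0 < δ)
    (hz : ball z δ ⊆ D) :
    ∫⁻ x in ball z δ, ‖v x - ⨍ y in ball z δ, v y‖ₑ
      ≤ 2 ^ (n + 1) * ENNReal.ofReal δ * ∫⁻ x in D, g x := by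
  have hv0 : volume (ball z δ) ≠ 0 := (measure_ball_pos _ _ hδ).ne'
  have hvt : volume (ball z δ) ≠ ⊤ := measure_ball_lt_top.ne
  have hint := h.integrableOn_ball hv hg hz
  calc ∫⁻ x in ball z δ, ‖v x - ⨍ y in ball z δ, v y‖ₑ
      ≤ ∫⁻ x in ball z δ, (volume (ball z δ))⁻¹ * ∫⁻ y in ball z δ, ‖v x - v y‖ₑ := by
        refine lintegral_mono fun x => ?_
        rw [enorm_sub_rev]
        refine (enorm_setAverage_sub_le hv0 hvt hint _).trans_eq ?_
        simp_rw [enorm_sub_rev (v x)]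
    _ = (volume (ball z δ))⁻¹ * ∫⁻ x in ball z δ, ∫⁻ y in ball z δ, ‖v x - v y‖ₑ :=
        lintegral_const_mul' _ _ (ENNReal.inv_ne_top.2 hv0)
    _ ≤ (volume (ball z δ))⁻¹ *
          (2 ^ (n + 1) * ENNReal.ofReal δ * volume (ball z δ) * ∫⁻ x in D, g x) := by
        gcongr
        exact (h.lintegral_lintegral_le_of_ball_subset hv hz).trans
          (mul_le_mul_right (lintegral_mono_set hz) _)
    _ = (volume (ball z δ))⁻¹ * volume (ball z δ) *
          (2 ^ (n + 1) * ENNReal.ofReal δ * ∫⁻ x in D, g x) := by ring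
    _ = _ := by rw [ENNReal.inv_mul_cancel hv0 hvt, one_mul]

end HasBallPoincare

theorem HasWeakGradientOn.aemeasurable
    {G : EuclideanSpace ℝ (Fin n) → EuclideanSpace ℝ (Fin n)} (h : HasWeakGradientOn v G D) :
    AEMeasurable v (volume.restrict D) :=
  h.locallyIntegrableOn.aestronglyMeasurable.aemeasurable

end CentralBall

/-! ### Estimates on dyadic level sets -/

section LevelEstimate

open Metric

theorem enorm_setAverage_smoothTruncation_le {Ω : Type*} [MeasurableSpace Ω] {μ : Measure Ω}
    {B : Set Ω} {v : Ω → ℝ} {l : ℝ} (hl : 0 < l)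
    (hv : ∫⁻ x in B, ‖v x‖ₑ ∂μ ≤ ENNReal.ofReal (l / 2) * μ B) :
    ‖⨍ x in B, l * smoothTruncation (v x / l) ∂μ‖ₑ ≤ ENNReal.ofReal (l / 2) := by
  have htrunc : ∀ t, ‖l * smoothTruncation (t / l)‖ₑ ≤ ‖t‖ₑ := fun t => by
    rw [enorm_le_iff_norm_le,
      Real.norm_of_nonneg (mul_nonneg hl.le (smoothTruncation_nonneg _))]
    exact mul_smoothTruncation_div_le_abs hl t
  calc ‖⨍ x in B, l * smoothTruncation (v x / l) ∂μ‖ₑ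
      ≤ ∫⁻ x, ‖l * smoothTruncation (v x / l)‖ₑ ∂((μ.restrict B univ)⁻¹ • μ.restrict B) :=
        enorm_integral_le_lintegral_enorm _
    _ = (μ B)⁻¹ * ∫⁻ x in B, ‖l * smoothTruncation (v x / l)‖ₑ ∂μ := by
        rw [lintegral_smul_measure, Measure.restrict_apply_univ, smul_eq_mul]
    _ ≤ (μ B)⁻¹ * (ENNReal.ofReal (l / 2) * μ B) := by
        gcongr
        exact (lintegral_mono fun x => htrunc (v x)).trans hv
    _ = ENNReal.ofReal (l / 2) * ((μ B)⁻¹ * μ B) := mul_left_comm _ _ _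
    _ ≤ ENNReal.ofReal (l / 2) := mul_le_of_le_one_right' (ENNReal.inv_mul_le_one _)

theorem variableRieszPotential_const_mul {X : Type*} [PseudoMetricSpace X] [MeasurableSpace X]
    {μ : Measure X} (a : X → ℝ) (g : X → ℝ≥0∞) {c : ℝ≥0∞} (hc : c ≠ ⊤) (x : X) :
    variableRieszPotential a (fun y => c * g y) μ x = c * variableRieszPotential a g μ x := by
  simp_rw [variableRieszPotential, mul_assoc]
  exact lintegral_const_mul' _ _ hc

theorem one_le_mul_and_mul_lt_of_lt_div {n : ℕ} (hn : 2 ≤ n) {σ : ℝ} (h1 : 1 ≤ σ)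
    (hσ : σ < (n : ℝ) / ((n : ℝ) - 1)) : 1 ≤ σ * (n - 1 : ℕ) ∧ σ * (n - 1 : ℕ) < n := by
  have hnR : (2 : ℝ) ≤ n := by exact_mod_cast hn
  rw [lt_div_iff₀ (by linarith)] at hσ
  rw [Nat.cast_sub (by omega), Nat.cast_one]
  exact ⟨one_le_mul_of_one_le_of_one_le h1 (by linarith), hσ⟩

theorem le_two_of_lt_div {n : ℕ} (hn : 2 ≤ n) {σ : ℝ} (hσ : σ < (n : ℝ) / ((n : ℝ) - 1)) :
    σ ≤ 2 := by
  have hnR : (2 : ℝ) ≤ n := by exact_mod_cast hn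
  refine hσ.le.trans ?_
  rw [div_le_iff₀ (by linarith)]
  linarith

namespace IsJohnDomain

variable {n : ℕ} {D : Set (EuclideanSpace ℝ (Fin n))} {s : EuclideanSpace ℝ (Fin n) → ℝ}
  {α β L sPlus l : ℝ} {x₀ : EuclideanSpace ℝ (Fin n)} {v : EuclideanSpace ℝ (Fin n) → ℝ}
  {g : EuclideanSpace ℝ (Fin n) → ℝ≥0∞} {M : ℝ≥0}

/-- The ratio between a level `l` of a function and the level that the potential of its gradient,
restricted to the values between `l` and `2 l`, exceeds where the function is larger than `2 l`;
`M` bounds the derivative of `smoothTruncation`. -/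
noncomputable def levelRatio (n : ℕ) (α β : ℝ) (M : ℝ≥0) : ℝ :=
  max 1 (4 * (potentialConst n α β * M))

theorem one_le_levelRatio : 1 ≤ levelRatio n α β M :=
  le_max_left _ _

theorem half_le_mul_variableRieszPotential (hn : 2 ≤ n) (hJ : IsJohnDomain D s α β x₀)
    (hs : ∀ x ∈ D, s x ≤ 2) (h : HasTruncationProperty v g D)
    (hv : AEMeasurable v (volume.restrict D)) (hg : AEMeasurable g (volume.restrict D))
    (hM : ∀ t, ‖deriv smoothTruncation t‖ₑ ≤ M) (hl : 0 < l)
    (hmean : ∫⁻ x in ball x₀ (infDist x₀ (frontier D) / 4), ‖v x‖ₑ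
      ≤ ENNReal.ofReal (l / 2) * volume (ball x₀ (infDist x₀ (frontier D) / 4))) :
    ∀ᵐ x ∂volume.restrict D, 2 * l ≤ |v x| → ENNReal.ofReal (l / 2)
      ≤ ENNReal.ofReal (potentialConst n α β * M) *
        variableRieszPotential (fun x => s x * (n - 1 : ℕ))
          ({x | l < |v x| ∧ |v x| < 2 * l}.indicator g) (volume.restrict D) x := by
  have hint : IntegrableOn (fun x => l * smoothTruncation (v x / l)) D := by
    refine IntegrableOn.of_bound hJ.isBounded.measure_lt_top ?_ l (ae_of_all _ fun x => ?_)
    · exact ((contDiff_smoothTruncation.continuous.measurable.comp_aemeasurable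
        (hv.div_const l)).const_mul l).aestronglyMeasurable
    · rw [Real.norm_of_nonneg (mul_nonneg hl.le (smoothTruncation_nonneg _))]
      exact mul_le_of_le_one_right hl.le (smoothTruncation_le_one _)
  have hgl : AEMeasurable ({x | l < |v x| ∧ |v x| < 2 * l}.indicator g) (volume.restrict D) :=
    hg.indicator₀ (hv.abs.nullMeasurableSet_preimage measurableSet_Ioo)
  filter_upwards [hJ.ae_enorm_sub_average_le hn hs (h.hasBallPoincare_smoothTruncation hM hl)
    hint (hgl.const_mul _)] with x hx hlx
  have hone : l * smoothTruncation (v x / l) = l := by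
    rw [smoothTruncation_eq_one, mul_one]
    rwa [abs_div, abs_of_pos hl, le_div_iff₀ hl]
  rw [hone, variableRieszPotential_const_mul _ _ ENNReal.coe_ne_top] at hx
  rw [ENNReal.ofReal_mul' M.coe_nonneg, ENNReal.ofReal_coe_nnreal, mul_assoc]
  refine le_trans ?_ hx
  have havg := enorm_setAverage_smoothTruncation_le hl hmean
  rw [← ofReal_norm, ENNReal.ofReal_le_ofReal_iff (by positivity), Real.norm_eq_abs] at havg
  rw [← ofReal_norm]
  exact ENNReal.ofReal_le_ofReal
    (le_trans (by linarith [(abs_le.1 havg).2]) (Real.le_norm_self _))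

theorem ae_div_levelRatio_lt_variableRieszPotential (hn : 2 ≤ n) (hJ : IsJohnDomain D s α β x₀)
    (hs : ∀ x ∈ D, s x ≤ 2) (h : HasTruncationProperty v g D)
    (hv : AEMeasurable v (volume.restrict D)) (hg : AEMeasurable g (volume.restrict D))
    (hM : ∀ t, ‖deriv smoothTruncation t‖ₑ ≤ M) (hl : 0 < l)
    (hmean : ∫⁻ x in ball x₀ (infDist x₀ (frontier D) / 4), ‖v x‖ₑ
      ≤ ENNReal.ofReal (l / 2) * volume (ball x₀ (infDist x₀ (frontier D) / 4))) :
    ∀ᵐ x ∂volume.restrict D, 2 * l ≤ |v x| → ENNReal.ofReal (l / levelRatio n α β M)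
      < variableRieszPotential (fun x => s x * (n - 1 : ℕ))
          ({x | l < |v x| ∧ |v x| < 2 * l}.indicator g) (volume.restrict D) x := by
  filter_upwards [hJ.half_le_mul_variableRieszPotential hn hs h hv hg hM hl hmean] with x hx hlx
  by_contra! hle
  have hΘ : 0 < levelRatio n α β M := zero_lt_one.trans_le one_le_levelRatio
  have hhalf : ENNReal.ofReal (l / 2) ≤ ENNReal.ofReal (l / 4) := calc
    _ ≤ ENNReal.ofReal (potentialConst n α β * M) * ENNReal.ofReal (l / levelRatio n α β M) :=
        (hx hlx).trans (by gcongr)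
    _ = ENNReal.ofReal (potentialConst n α β * M * (l / levelRatio n α β M)) :=
        (ENNReal.ofReal_mul' (by positivity)).symm
    _ ≤ ENNReal.ofReal (levelRatio n α β M / 4 * (l / levelRatio n α β M)) := by
        gcongr
        linarith [le_max_right 1 (4 * (potentialConst n α β * M)), levelRatio.eq_1 n α β M]
    _ = ENNReal.ofReal (l / 4) := by field_simp
  rw [ENNReal.ofReal_le_ofReal_iff (by positivity)] at hhalf
  linarith

/-- The constant in the weak type estimate of the potential with exponent `s(x) (n - 1)`. -/
noncomputable def weakTypeConst (n : ℕ) (β L sPlus : ℝ) : ℝ :=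
  largeKernelConst (volume : Measure (EuclideanSpace ℝ (Fin n))) (sPlus * (n - 1 : ℕ))
    ((max 1 (2 * β) * Real.exp L) ^ (n - 1))

theorem setLIntegral_superlevel_potential_le (hn : 2 ≤ n) (hJ : IsJohnDomain D s α β x₀)
    (hlog : LogHolderOnWith L s D) (hs : ∀ x ∈ D, s x ≤ sPlus)
    (hsPlus : sPlus < (n : ℝ) / ((n : ℝ) - 1)) (hg : AEMeasurable g (volume.restrict D))
    (hg1 : ∫⁻ x in D, g x ≤ 1) {t : ℝ} (ht : 1 ≤ t) :
    ∫⁻ x in {x | ENNReal.ofReal t < variableRieszPotential (fun x => s x * (n - 1 : ℕ)) g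
        (volume.restrict D) x}, ENNReal.ofReal (t ^ ((n : ℝ) / (s x * (n - 1 : ℕ))))
          ∂volume.restrict D
      ≤ 2 * ENNReal.ofReal (weakTypeConst n β L sPlus) * ∫⁻ x in D, g x := by
  have : NeZero n := ⟨by omega⟩
  have hs2 : ∀ x ∈ D, s x ≤ 2 := fun x hx => (hs x hx).trans (le_two_of_lt_div hn hsPlus)
  have hexp : ∀ x ∈ D, _ := fun x hx =>
    one_le_mul_and_mul_lt_of_lt_div hn (hJ.one_le x hx) ((hs x hx).trans_lt hsPlus)
  have hsPlus1 : 1 ≤ sPlus := (hJ.one_le _ hJ.center_mem).trans (hs _ hJ.center_mem)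
  have hfreeze := hlog.hasFreezingBound_mul (le_max_left 1 (2 * β))
    (fun x hx y hy => (hJ.dist_le hx hy).trans (le_max_right _ _))
    (fun x hx y hy => abs_sub_le_iff.2 ⟨by linarith [hs2 x hx, hJ.one_le y hy],
      by linarith [hs2 y hy, hJ.one_le x hx]⟩) (n - 1)
  have hweak := setLIntegral_superlevel_variableRieszPotential_le volume (A := sPlus * (n - 1 : ℕ))
    hJ.isOpen.measurableSet hJ.isBounded.measure_lt_top.ne (hlog.continuousOn.mul_const _) hg
    (one_le_pow₀ (one_le_mul_of_one_le_of_one_le (le_max_left _ _)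
      (Real.one_le_exp hlog.1.le))) hfreeze (fun x hx => (hexp x hx).1)
    (fun x hx => mul_le_mul_of_nonneg_right (hs x hx) (Nat.cast_nonneg _))
    (by simpa using (one_le_mul_and_mul_lt_of_lt_div hn hsPlus1 hsPlus).2) hg1 ht
  rw [finrank_euclideanSpace_fin] at hweak
  rwa [Measure.restrict_restrict' hJ.isOpen.measurableSet, inter_comm]

/-- The constant in the estimate of the superlevel sets of a function by its gradient. -/
noncomputable def levelConst (n : ℕ) (α β L sPlus : ℝ) (M : ℝ≥0) : ℝ≥0∞ :=
  ENNReal.ofReal (levelRatio n α β M ^ n) * (2 * ENNReal.ofReal (weakTypeConst n β L sPlus))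

theorem setLIntegral_superlevel_le (hn : 2 ≤ n) (hJ : IsJohnDomain D s α β x₀)
    (hlog : LogHolderOnWith L s D) (hs : ∀ x ∈ D, s x ≤ sPlus)
    (hsPlus : sPlus < (n : ℝ) / ((n : ℝ) - 1)) (h : HasTruncationProperty v g D)
    (hv : AEMeasurable v (volume.restrict D)) (hg : AEMeasurable g (volume.restrict D))
    (hg1 : ∫⁻ x in D, g x ≤ 1) (hM : ∀ t, ‖deriv smoothTruncation t‖ₑ ≤ M)
    (hl : levelRatio n α β M ≤ l)
    (hmean : ∫⁻ x in ball x₀ (infDist x₀ (frontier D) / 4), ‖v x‖ₑ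
      ≤ ENNReal.ofReal (l / 2) * volume (ball x₀ (infDist x₀ (frontier D) / 4))) :
    ∫⁻ x in {x | 2 * l ≤ |v x|}, ENNReal.ofReal (l ^ ((n : ℝ) / (s x * (n - 1 : ℕ))))
        ∂volume.restrict D
      ≤ levelConst n α β L sPlus M *
        ∫⁻ x in {x | l < |v x| ∧ |v x| < 2 * l}, g x ∂volume.restrict D := by
  set Θ := levelRatio n α β M
  set gl := {x | l < |v x| ∧ |v x| < 2 * l}.indicator g
  have hΘ1 : 1 ≤ Θ := one_le_levelRatio
  have hΘ0 : 0 < Θ := zero_lt_one.trans_le hΘ1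
  have hlevel : NullMeasurableSet {x | l < |v x| ∧ |v x| < 2 * l} (volume.restrict D) :=
    hv.abs.nullMeasurableSet_preimage measurableSet_Ioo
  have hgl1 : ∫⁻ x in D, gl x ≤ 1 := (lintegral_mono (indicator_le_self _ g)).trans hg1
  have hsub := hJ.ae_div_levelRatio_lt_variableRieszPotential hn
    (fun x hx => (hs x hx).trans (le_two_of_lt_div hn hsPlus)) h hv hg hM (hΘ0.trans_le hl) hmean
  have hscale : ∀ x ∈ D, ENNReal.ofReal (l ^ ((n : ℝ) / (s x * (n - 1 : ℕ))))
      ≤ ENNReal.ofReal (Θ ^ n) *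
        ENNReal.ofReal ((l / Θ) ^ ((n : ℝ) / (s x * (n - 1 : ℕ)))) := fun x hx => by
    have hexp := one_le_mul_and_mul_lt_of_lt_div hn (hJ.one_le x hx) ((hs x hx).trans_lt hsPlus)
    rw [← ENNReal.ofReal_mul (by positivity), Real.div_rpow (hΘ0.le.trans hl) hΘ0.le]
    refine ENNReal.ofReal_le_ofReal ?_
    rw [mul_div_left_comm]
    refine le_mul_of_one_le_right (by have := hΘ0.le.trans hl; positivity) ?_
    rw [one_le_div (by positivity), ← Real.rpow_natCast]
    exact Real.rpow_le_rpow_of_exponent_le hΘ1 (div_le_self (by positivity) hexp.1)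
  refine (lintegral_mono_ae (ae_restrict_of_ae ((ae_restrict_mem hJ.isOpen.measurableSet).mono
    hscale))).trans ?_
  rw [lintegral_const_mul' _ _ ENNReal.ofReal_ne_top, levelConst, mul_assoc,
    ← lintegral_indicator₀ hlevel]
  gcongr
  exact (lintegral_mono' (Measure.restrict_mono_ae hsub) le_rfl).trans
    (hJ.setLIntegral_superlevel_potential_le hn hlog hs hsPlus (hg.indicator₀ hlevel) hgl1
      ((one_le_div hΘ0).2 hl))

end IsJohnDomain

end LevelEstimate

/-! ### From level sets to the Luxemburg norm -/

section DyadicSummation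

variable {Ω : Type*} {f q : Ω → ℝ} {l₀ : ℝ}

theorem exists_dyadic_rpow_le {y q d : ℝ} (hl₀ : 0 < l₀) (hy : 2 * l₀ ≤ y) (hq : 0 ≤ q)
    (hqd : q ≤ d) :
    ∃ j : ℕ, 2 * (2 ^ j * l₀) ≤ y ∧ y ^ q ≤ 4 ^ d * (2 ^ j * l₀) ^ q := by
  obtain ⟨j, hj, hj'⟩ := exists_nat_pow_near
    (show 1 ≤ y / (2 * l₀) by rwa [one_le_div (by positivity)]) one_lt_two
  rw [le_div_iff₀ (by positivity)] at hj
  rw [div_lt_iff₀ (by positivity), pow_succ] at hj'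
  refine ⟨j, by linarith, ?_⟩
  calc y ^ q ≤ (4 * (2 ^ j * l₀)) ^ q :=
        Real.rpow_le_rpow (by linarith) (by linarith) hq
    _ = 4 ^ q * (2 ^ j * l₀) ^ q := Real.mul_rpow (by norm_num) (by positivity)
    _ ≤ 4 ^ d * (2 ^ j * l₀) ^ q := by
        gcongr
        norm_num

theorem ofReal_rpow_le_add_tsum_dyadic {d : ℝ} (hl₀ : 0 < l₀) {x : Ω} (hf : 0 ≤ f x)
    (hq : 0 ≤ q x) (hqd : q x ≤ d) :
    ENNReal.ofReal (f x ^ q x) ≤ ENNReal.ofReal (max 1 (2 * l₀) ^ d) +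
      ENNReal.ofReal (4 ^ d) * ∑' j : ℕ, {x | 2 * (2 ^ j * l₀) ≤ f x}.indicator
        (fun x => ENNReal.ofReal ((2 ^ j * l₀) ^ q x)) x := by
  rcases le_total (f x) (2 * l₀) with hx | hx
  · refine le_add_right (ENNReal.ofReal_le_ofReal ?_)
    exact (Real.rpow_le_rpow hf (hx.trans (le_max_right 1 _)) hq).trans
      (Real.rpow_le_rpow_of_exponent_le (le_max_left _ _) hqd)
  · obtain ⟨j, hj, hpow⟩ := exists_dyadic_rpow_le hl₀ hx hq hqd
    refine le_add_left ?_
    calc ENNReal.ofReal (f x ^ q x)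
        ≤ ENNReal.ofReal (4 ^ d) * ENNReal.ofReal ((2 ^ j * l₀) ^ q x) := by
          rw [← ENNReal.ofReal_mul (by positivity)]
          exact ENNReal.ofReal_le_ofReal hpow
      _ = ENNReal.ofReal (4 ^ d) * {x | 2 * (2 ^ j * l₀) ≤ f x}.indicator
            (fun x => ENNReal.ofReal ((2 ^ j * l₀) ^ q x)) x := by
          rw [indicator_of_mem (by exact hj)]
      _ ≤ _ := by
          gcongr
          exact ENNReal.le_tsum (f := fun j : ℕ => {x | 2 * (2 ^ j * l₀) ≤ f x}.indicator
            (fun x => ENNReal.ofReal ((2 ^ j * l₀) ^ q x)) x) j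

variable [MeasurableSpace Ω] {μ : Measure Ω}

theorem tsum_setLIntegral_dyadic_le (hf : AEMeasurable f μ) (hl₀ : 0 ≤ l₀) (h : Ω → ℝ≥0∞) :
    ∑' j : ℕ, ∫⁻ x in {x | 2 ^ j * l₀ < f x ∧ f x < 2 * (2 ^ j * l₀)}, h x ∂μ
      ≤ ∫⁻ x, h x ∂μ := by
  have hmono : Monotone fun j : ℕ => 2 ^ j * l₀ := fun i j hij =>
    mul_le_mul_of_nonneg_right (pow_le_pow_right₀ one_le_two hij) hl₀
  have hdisj : Pairwise (Function.onFun (AEDisjoint μ) fun j : ℕ =>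
      {x | 2 ^ j * l₀ < f x ∧ f x < 2 * (2 ^ j * l₀)}) := fun i j hij => by
    have hIoo := hmono.pairwise_disjoint_on_Ioo_succ hij
    simp only [Function.onFun, Order.succ_eq_add_one, pow_succ', mul_assoc] at hIoo
    exact (hIoo.preimage f).aedisjoint
  refine (lintegral_iUnion₀ (fun j => hf.nullMeasurableSet_preimage measurableSet_Ioo)
    hdisj h).ge.trans ?_
  exact setLIntegral_le_lintegral _ _

theorem lintegral_rpow_le_of_level_estimate (hf0 : ∀ x, 0 ≤ f x) (hf : AEMeasurable f μ)
    (hq : AEMeasurable q μ) {d : ℝ} (hqd : ∀ᵐ x ∂μ, 0 ≤ q x ∧ q x ≤ d) {h : Ω → ℝ≥0∞}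
    {C : ℝ≥0∞} (hl₀ : 0 < l₀)
    (hlevel : ∀ l, l₀ ≤ l → ∫⁻ x in {x | 2 * l ≤ f x}, ENNReal.ofReal (l ^ q x) ∂μ
      ≤ C * ∫⁻ x in {x | l < f x ∧ f x < 2 * l}, h x ∂μ) :
    ∫⁻ x, ENNReal.ofReal (f x ^ q x) ∂μ
      ≤ ENNReal.ofReal (max 1 (2 * l₀) ^ d) * μ univ +
        ENNReal.ofReal (4 ^ d) * (C * ∫⁻ x, h x ∂μ) := by
  have hset : ∀ j : ℕ, NullMeasurableSet {x | 2 * (2 ^ j * l₀) ≤ f x} μ := fun j =>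
    hf.nullMeasurableSet_preimage measurableSet_Ici
  refine (lintegral_mono_ae (hqd.mono fun x hx =>
    ofReal_rpow_le_add_tsum_dyadic hl₀ (hf0 x) hx.1 hx.2)).trans ?_
  rw [lintegral_add_left measurable_const, lintegral_const,
    lintegral_const_mul' _ _ ENNReal.ofReal_ne_top,
    lintegral_tsum fun j => (aemeasurable_const.pow hq).ennreal_ofReal.indicator₀ (hset j)]
  gcongr
  calc ∑' j : ℕ, ∫⁻ x, {x | 2 * (2 ^ j * l₀) ≤ f x}.indicator
        (fun x => ENNReal.ofReal ((2 ^ j * l₀) ^ q x)) x ∂μ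
      ≤ ∑' j : ℕ, C * ∫⁻ x in {x | 2 ^ j * l₀ < f x ∧ f x < 2 * (2 ^ j * l₀)}, h x ∂μ := by
        refine ENNReal.tsum_le_tsum fun j => ?_
        rw [lintegral_indicator₀ (hset j)]
        exact hlevel _ (le_mul_of_one_le_left hl₀.le (one_le_pow₀ one_le_two))
    _ ≤ C * ∫⁻ x, h x ∂μ := by
        rw [ENNReal.tsum_mul_left]
        gcongr
        exact tsum_setLIntegral_dyadic_le hf hl₀.le h

end DyadicSummation

section Luxemburg

variable {n : ℕ}

theorem luxemburgNorm_le_of_modular_le {p f : EuclideanSpace ℝ (Fin n) → ℝ}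
    {U : Set (EuclideanSpace ℝ (Fin n))} (hU : MeasurableSet U) (hp : ∀ x ∈ U, 1 ≤ p x) {N C : ℝ}
    (hN : 0 < N) (hC : 1 ≤ C) (h : modular p (fun x => f x / N) U ≤ ENNReal.ofReal C) :
    luxemburgNorm p f U ≤ ENNReal.ofReal (C * N) := by
  have hC0 : 0 < C := by linarith
  refine iInf₂_le (C * N) ⟨by positivity, ?_⟩
  calc modular p (fun x => f x / (C * N)) U
      ≤ ∫⁻ x in U, ENNReal.ofReal C⁻¹ * ENNReal.ofReal (|f x / N| ^ p x) := by
        refine setLIntegral_mono' hU fun x hx => ?_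
        rw [← ENNReal.ofReal_mul (by positivity)]
        refine ENNReal.ofReal_le_ofReal ?_
        have hfactor : |f x / (C * N)| = C⁻¹ * |f x / N| := by
          rw [mul_comm C, ← div_div, abs_div, abs_of_pos hC0, div_eq_inv_mul]
        rw [hfactor, Real.mul_rpow (by positivity) (by positivity)]
        gcongr
        exact Real.rpow_le_self_of_le_one (by positivity) (inv_le_one_of_one_le₀ hC) (hp x hx)
    _ = ENNReal.ofReal C⁻¹ * modular p (fun x => f x / N) U :=
        lintegral_const_mul' _ _ ENNReal.ofReal_ne_top
    _ ≤ ENNReal.ofReal C⁻¹ * ENNReal.ofReal C := by gcongr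
    _ = 1 := by
        rw [← ENNReal.ofReal_mul (by positivity), inv_mul_cancel₀ hC0.ne', ENNReal.ofReal_one]

theorem le_mul_of_forall_le_ofReal {X Y C : ℝ≥0∞} (hX : X ≠ ⊤) (hC : C ≠ ⊤)
    (h : ∀ N : ℝ, 0 < N → X ≤ ENNReal.ofReal N → Y ≤ C * ENNReal.ofReal N) : Y ≤ C * X := by
  have hlim : Filter.Tendsto (fun ε : ℝ => C * ENNReal.ofReal (X.toReal + ε))
      (nhdsWithin 0 (Ioi 0)) (nhds (C * X)) := by
    refine ENNReal.Tendsto.const_mul ?_ (Or.inr hC)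
    nth_rw 2 [← ENNReal.ofReal_toReal hX]
    refine ENNReal.tendsto_ofReal (tendsto_nhdsWithin_of_tendsto_nhds ?_)
    simpa using (continuous_const_add X.toReal).tendsto 0
  refine ge_of_tendsto hlim (eventually_mem_nhdsWithin.mono fun ε (hε : 0 < ε) => ?_)
  refine h _ (by positivity) ?_
  rw [← ENNReal.ofReal_toReal hX]
  exact ENNReal.ofReal_le_ofReal (by rw [ENNReal.toReal_ofReal (by positivity)]; linarith)

theorem le_of_essSupOn_le {s : EuclideanSpace ℝ (Fin n) → ℝ} {D : Set (EuclideanSpace ℝ (Fin n))}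
    {sPlus : ℝ} (hD : IsOpen D) (hs : ContinuousOn s D) (h : essSupOn s D ≤ (sPlus : EReal)) :
    ∀ x ∈ D, s x ≤ sPlus := by
  intro x hx
  by_contra! hlt
  have hae : ∀ᵐ y ∂volume.restrict D, s y ≤ sPlus :=
    (ae_le_essSup (f := fun x => (s x : EReal))).mono fun y hy =>
      EReal.coe_le_coe_iff.1 (hy.trans h)
  have hpos : 0 < volume (D ∩ s ⁻¹' Ioi sPlus) :=
    (hs.isOpen_inter_preimage hD isOpen_Ioi).measure_pos _ ⟨x, hx, hlt⟩
  rw [ae_restrict_iff' hD.measurableSet] at hae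
  refine hpos.ne' (measure_mono_null (fun y hy => ?_) (ae_iff.1 hae))
  simp only [mem_ofPred_eq, Classical.not_imp, not_le]
  exact ⟨hy.1, hy.2⟩

end Luxemburg

section SobolevPoincare

open Metric

namespace IsJohnDomain

variable {n : ℕ} {D : Set (EuclideanSpace ℝ (Fin n))} {s : EuclideanSpace ℝ (Fin n) → ℝ}
  {α β δ L l sPlus : ℝ} {x₀ : EuclideanSpace ℝ (Fin n)} {v : EuclideanSpace ℝ (Fin n) → ℝ}
  {g : EuclideanSpace ℝ (Fin n) → ℝ≥0∞} {M : ℝ≥0}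

/-- The level from which on the level set estimates apply to functions with mean value zero over
the ball of radius `δ` around the John center and with gradient of norm at most one. -/
noncomputable def firstLevel (n : ℕ) (α β δ : ℝ) (M : ℝ≥0) : ℝ :=
  max (levelRatio n α β M)
    (2 * (2 ^ (n + 1) * δ / volume.real (ball (0 : EuclideanSpace ℝ (Fin n)) (δ / 4))))

/-- The bound on the modular of functions with mean value zero over the ball of radius `δ` around
the John center and with gradient of norm at most one. -/
noncomputable def modularConst (n : ℕ) (α β δ L sPlus : ℝ) (M : ℝ≥0) : ℝ≥0∞ :=
  ENNReal.ofReal (max 1 (2 * firstLevel n α β δ M) ^ (n : ℝ)) *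
      volume (closedBall (0 : EuclideanSpace ℝ (Fin n)) β) +
    ENNReal.ofReal (4 ^ (n : ℝ)) * levelConst n α β L sPlus M

theorem modularConst_ne_top : modularConst n α β δ L sPlus M ≠ ⊤ := by
  have hvol := (measure_closedBall_lt_top (μ := volume)
    (x := (0 : EuclideanSpace ℝ (Fin n))) (r := β)).ne
  unfold modularConst levelConst
  finiteness

theorem lintegral_enorm_le_of_firstLevel_le (hδ : 0 < δ) (hl : firstLevel n α β δ M ≤ l)
    (hv : ∫⁻ x in ball x₀ δ, ‖v x‖ₑ ≤ ENNReal.ofReal (2 ^ (n + 1) * δ)) :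
    ∫⁻ x in ball x₀ (δ / 4), ‖v x‖ₑ ≤ ENNReal.ofReal (l / 2) * volume (ball x₀ (δ / 4)) := by
  have hvol : 0 < volume.real (ball (0 : EuclideanSpace ℝ (Fin n)) (δ / 4)) :=
    ENNReal.toReal_pos (measure_ball_pos _ _ (by positivity)).ne' measure_ball_lt_top.ne
  have hl' := (le_max_right _ _).trans hl
  rw [← le_div_iff₀' two_pos, div_le_iff₀ hvol] at hl'
  calc ∫⁻ x in ball x₀ (δ / 4), ‖v x‖ₑ ≤ ∫⁻ x in ball x₀ δ, ‖v x‖ₑ :=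
        lintegral_mono_set (ball_subset_ball (by linarith))
    _ ≤ ENNReal.ofReal (l / 2 * volume.real (ball (0 : EuclideanSpace ℝ (Fin n)) (δ / 4))) :=
        hv.trans (ENNReal.ofReal_le_ofReal hl')
    _ = ENNReal.ofReal (l / 2) * volume (ball x₀ (δ / 4)) := by
        rw [ENNReal.ofReal_mul' hvol.le, ofReal_measureReal, ← Measure.addHaar_ball_center _ x₀]

theorem volume_le_volume_closedBall (hJ : IsJohnDomain D s α β x₀) :
    volume D ≤ volume (closedBall (0 : EuclideanSpace ℝ (Fin n)) β) := by
  rw [← Measure.addHaar_closedBall_center volume x₀]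
  exact measure_mono fun x hx => hJ.dist_center_le hx

theorem one_le_exponent_and_exponent_le (hn : 2 ≤ n) (hJ : IsJohnDomain D s α β x₀)
    (hs : ∀ x ∈ D, s x ≤ sPlus) (hsPlus : sPlus < (n : ℝ) / ((n : ℝ) - 1))
    {x : EuclideanSpace ℝ (Fin n)} (hx : x ∈ D) :
    1 ≤ (n : ℝ) / (s x * (n - 1 : ℕ)) ∧ (n : ℝ) / (s x * (n - 1 : ℕ)) ≤ n := by
  obtain ⟨h1, hlt⟩ :=
    one_le_mul_and_mul_lt_of_lt_div hn (hJ.one_le x hx) ((hs x hx).trans_lt hsPlus)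
  exact ⟨(one_le_div (by linarith)).2 hlt.le, div_le_self n.cast_nonneg h1⟩

theorem modular_le (hn : 2 ≤ n) (hJ : IsJohnDomain D s α β x₀)
    (hδ : infDist x₀ (frontier D) = δ) (hlog : LogHolderOnWith L s D)
    (hs : ∀ x ∈ D, s x ≤ sPlus) (hsPlus : sPlus < (n : ℝ) / ((n : ℝ) - 1))
    (h : HasTruncationProperty v g D) (hv : AEMeasurable v (volume.restrict D))
    (hg : AEMeasurable g (volume.restrict D)) (hg1 : ∫⁻ x in D, g x ≤ 1)
    (hM : ∀ t, ‖deriv smoothTruncation t‖ₑ ≤ M)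
    (hmean : ∫⁻ x in ball x₀ δ, ‖v x‖ₑ ≤ ENNReal.ofReal (2 ^ (n + 1) * δ)) :
    modular (fun x => (n : ℝ) / (s x * (n - 1 : ℕ))) v D ≤ modularConst n α β δ L sPlus M := by
  have : NeZero n := ⟨by omega⟩
  have hD := hJ.isOpen.measurableSet
  have hlevel : ∀ l, firstLevel n α β δ M ≤ l → _ := fun l hl =>
    hJ.setLIntegral_superlevel_le hn hlog hs hsPlus h hv hg hg1 hM ((le_max_left _ _).trans hl)
      (hδ ▸ lintegral_enorm_le_of_firstLevel_le (hδ ▸ hJ.infDist_frontier_pos hJ.center_mem) hl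
        hmean)
  have hfirst : 0 < firstLevel n α β δ M :=
    zero_lt_one.trans_le (one_le_levelRatio.trans (le_max_left _ _))
  refine (lintegral_rpow_le_of_level_estimate (d := n) (fun x => abs_nonneg (v x)) hv.abs
    (((hlog.continuousOn.aemeasurable hD).mul_const _).const_div _)
    ((ae_restrict_mem hD).mono fun x hx => ?_) hfirst hlevel).trans ?_
  · have hexp := hJ.one_le_exponent_and_exponent_le hn hs hsPlus hx
    exact ⟨zero_le_one.trans hexp.1, hexp.2⟩
  · rw [Measure.restrict_apply_univ, modularConst]
    gcongr _ * ?_ + _ * ?_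
    · exact hJ.volume_le_volume_closedBall
    · exact mul_le_of_le_one_right' hg1

/-- The constant in the Sobolev–Poincaré inequality. -/
noncomputable def sobolevPoincareConst (n : ℕ) (α β δ L sPlus : ℝ) (M : ℝ≥0) : ℝ≥0 :=
  max 1 (modularConst n α β δ L sPlus M).toNNReal

theorem luxemburgNorm_sub_average_le (hn : 2 ≤ n) (hJ : IsJohnDomain D s α β x₀)
    (hδ : infDist x₀ (frontier D) = δ) (hlog : LogHolderOnWith L s D)
    (hs : ∀ x ∈ D, s x ≤ sPlus) (hsPlus : sPlus < (n : ℝ) / ((n : ℝ) - 1))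
    (h : HasTruncationProperty v g D) (hv : AEMeasurable v (volume.restrict D))
    (hg : AEMeasurable g (volume.restrict D)) (hgD : ∫⁻ x in D, g x ≠ ⊤)
    (hM : ∀ t, ‖deriv smoothTruncation t‖ₑ ≤ M) :
    luxemburgNorm (fun x => (n : ℝ) / (s x * (n - 1 : ℕ)))
        (fun x => v x - ⨍ y in ball x₀ δ, v y) D
      ≤ sobolevPoincareConst n α β δ L sPlus M * ∫⁻ x in D, g x := by
  have : NeZero n := ⟨by omega⟩
  have hδ0 : 0 < δ := hδ ▸ hJ.infDist_frontier_pos hJ.center_mem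
  have hball : ball x₀ δ ⊆ D := hδ ▸ ball_infDist_frontier_subset hJ.isOpen hJ.center_mem
  refine le_mul_of_forall_le_ofReal hgD ENNReal.coe_ne_top fun N hN hgN => ?_
  set a := ⨍ y in ball x₀ δ, v y
  have hN0 : ENNReal.ofReal N ≠ 0 := (ENNReal.ofReal_pos.2 hN).ne'
  have hnorm : ∫⁻ x in D, g x / ENNReal.ofReal N ≤ 1 := by
    simp_rw [div_eq_mul_inv]
    rw [lintegral_mul_const' _ _ (ENNReal.inv_ne_top.2 hN0), ← div_eq_mul_inv]
    exact ENNReal.div_le_of_le_mul (by rwa [one_mul])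
  have hmean : ∫⁻ x in ball x₀ δ, ‖(v x - a) / N‖ₑ ≤ ENNReal.ofReal (2 ^ (n + 1) * δ) := by
    simp_rw [div_eq_mul_inv, enorm_mul, enorm_inv hN.ne', Real.enorm_eq_ofReal hN.le]
    rw [lintegral_mul_const' _ _ (ENNReal.inv_ne_top.2 hN0), ← div_eq_mul_inv]
    refine ENNReal.div_le_of_le_mul
      ((h.hasBallPoincare.lintegral_enorm_sub_average_le hv hgD hδ0 hball).trans ?_)
    rw [ENNReal.ofReal_mul (by positivity), ENNReal.ofReal_pow zero_le_two, ENNReal.ofReal_ofNat]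
    gcongr
  have hmod := hJ.modular_le hn hδ hlog hs hsPlus (h.sub_const_div_const a hN)
    ((hv.sub_const a).div_const N) (hg.div_const _) hnorm hM hmean
  rw [← ENNReal.ofReal_coe_nnreal, ← ENNReal.ofReal_mul NNReal.zero_le_coe]
  refine luxemburgNorm_le_of_modular_le hJ.isOpen.measurableSet
    (fun x hx => (hJ.one_le_exponent_and_exponent_le hn hs hsPlus hx).1) hN
    (by exact_mod_cast le_max_left _ _) (hmod.trans ?_)
  rw [ENNReal.ofReal_coe_nnreal, ← ENNReal.coe_toNNReal modularConst_ne_top]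
  exact_mod_cast le_max_right _ _

end IsJohnDomain

end SobolevPoincare

theorem mainTheorem5 (n : ℕ) (hn : 2 ≤ n) (α β sPlus δ L : ℝ) :
    ∃ c : ℝ≥0,
      ∀ (D : Set (EuclideanSpace ℝ (Fin n))) (s : EuclideanSpace ℝ (Fin n) → ℝ)
        (x₀ : EuclideanSpace ℝ (Fin n)),
        IsJohnDomain D s α β x₀ →
        Metric.infDist x₀ (frontier D) = δ →
        IsVariableExponent s D →
        LogHolderOnWith L s D →
        1 ≤ essInfOn s D →
        essSupOn s D = (sPlus : EReal) →
        sPlus < (n : ℝ) / ((n : ℝ) - 1) →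
        ∀ (u : EuclideanSpace ℝ (Fin n) → ℝ)
          (G : EuclideanSpace ℝ (Fin n) → EuclideanSpace ℝ (Fin n)),
          MemL11With u G D →
          IntegrableOn u (Metric.ball x₀ δ) ∧
          luxemburgNorm (fun x => (n : ℝ) / (s x * ((n : ℝ) - 1)))
              (fun x => u x - ⨍ y in Metric.ball x₀ δ, u y) D
            ≤ (c : ℝ≥0∞) * eLpNorm G 1 (volume.restrict D) := by
  obtain ⟨M, hM⟩ := exists_enorm_deriv_smoothTruncation_le
  refine ⟨IsJohnDomain.sobolevPoincareConst n α β δ L sPlus M, ?_⟩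
  intro D s x₀ hJ hδ _ hlog _ hsup hsPlus u G hu
  have hball : Metric.ball x₀ δ ⊆ D :=
    hδ ▸ ball_infDist_frontier_subset hJ.isOpen hJ.center_mem
  have htrunc := hu.1.hasTruncationProperty hJ.isOpen
  have hG : ∫⁻ x in D, ‖G x‖ₑ ≠ ⊤ := hu.2.2.ne
  refine ⟨htrunc.hasBallPoincare.integrableOn_ball hu.1.aemeasurable hG hball, ?_⟩
  have hs := le_of_essSupOn_le hJ.isOpen hlog.continuousOn hsup.le
  rw [eLpNorm_one_eq_lintegral_enorm, ← Nat.cast_pred (by omega : 0 < n)]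
  exact hJ.luxemburgNorm_sub_average_le hn hδ hlog hs hsPlus htrunc hu.1.aemeasurable
    hu.2.aestronglyMeasurable.enorm hG hM
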